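/- Let $(S_i)_{i\ge 0}$ be a simple symmetric random walk on $\mathbb{Z}$ with $S_0=0$, and let $e_i$ denote the edge from $(i,S_i)$ to $(i+1,S_{i+1})$ in its graph. Let $$\mathcal{G}_n:=\sum_{i=0}^{n-1}\left(\mathbf{1}_{\{e_i\text{ lies above the }x\text{-axis}\}}-\mathbf{1}_{\{e_i\text{ lies below the }x\text{-axis}\}}\right)$$ be the associated time process (an edge may have one endpoint on the axis). For $i\ge 1$ let $\tau_i:=\sup\{0\le t<i : S_{2t}=0\}$, and say that $(S,\mathcal{G})$ completes a half winding around the origin at step $2i$ if $S_{2i}=S_{2\tau_i}=0$ and $\mathcal{G}_{2\tau_i}\,\mathcal{G}_{2i}<0$. Let the winding number $\mathcal{N}_{\mathcal{G}}(n)$ up to time $n$ be one half of the number of integers $i$ with $1\le i\le n/2$ such that a half winding is completed at step $2i$. Then $$\frac{\mathcal{N}_{\mathcal{G}}(n)}{\log n}\longrightarrow\frac{1}{2\pi}\qquad\text{almost surely as } n\to\infty.$$ -/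

import Mathlib

open MeasureTheory ProbabilityTheory Filter
open scoped Topology

namespace RevolvingWalk

/-- `S` is a simple (symmetric, nearest-neighbour) random walk on `ℤ` started at `0`: the increments
are independent and each of them equals `1` or `-1` with probability `1/2`. -/
structure IsSimpleRandomWalk {Ω : Type*} [MeasurableSpace Ω] (S : ℕ → Ω → ℤ) (μ : Measure Ω) :
    Prop where
  measurable : ∀ n, Measurable (S n)
  zero : ∀ᵐ ω ∂μ, S 0 ω = 0
  indep : iIndepFun (fun (n : ℕ) (ω : Ω) => S (n + 1) ω - S n ω) μ
  step_up : ∀ n, μ {ω | S (n + 1) ω - S n ω = 1} = 1 / 2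
  step_down : ∀ n, μ {ω | S (n + 1) ω - S n ω = -1} = 1 / 2

/-- The edge `e_i` joining `(i, s i)` to `(i + 1, s (i + 1))` lies above the `x`-axis
(endpoints on the axis are allowed). -/
def EdgeAbove (s : ℕ → ℤ) (i : ℕ) : Prop := 0 ≤ s i ∧ 0 ≤ s (i + 1)

/-- The edge `e_i` joining `(i, s i)` to `(i + 1, s (i + 1))` lies below the `x`-axis
(endpoints on the axis are allowed). -/
def EdgeBelow (s : ℕ → ℤ) (i : ℕ) : Prop := s i ≤ 0 ∧ s (i + 1) ≤ 0

open Classical in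
/-- The associated time process `G_n` of a path `s`: the number of the edges `e_0, …, e_{n-1}` above
the `x`-axis minus the number of those below it. -/
noncomputable def timeProcess (s : ℕ → ℤ) (n : ℕ) : ℤ :=
  ∑ i ∈ Finset.range n, ((if EdgeAbove s i then 1 else 0) - (if EdgeBelow s i then 1 else 0))

/-- `τ_i = sup {t < i : s (2 t) = 0}`, so that `2 τ_i` is the last time before `2 i` at which the
path is at `0`. For `i ≥ 1` and `s 0 = 0` the set is nonempty and finite. -/
noncomputable def lastZero (s : ℕ → ℤ) (i : ℕ) : ℕ := sSup {t : ℕ | t < i ∧ s (2 * t) = 0}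

/-- The process `(s, G)` just completed a half winding around the origin at step `2 i`:
`s (2 i) = s (2 τ_i) = 0` and `G` has opposite signs at the times `2 τ_i` and `2 i`. -/
def HalfWindingAt (s : ℕ → ℤ) (i : ℕ) : Prop :=
  s (2 * i) = 0 ∧ s (2 * lastZero s i) = 0 ∧
    timeProcess s (2 * lastZero s i) * timeProcess s (2 * i) < 0

open Classical in
/-- The number of windings of `(s, G)` up to time `n`: one half of the number of half windings
completed up to time `n` (all of which are completed at even times). -/
noncomputable def windingNumber (s : ℕ → ℤ) (n : ℕ) : ℝ :=
  (1 / 2) * ∑ i ∈ Finset.Icc 1 (n / 2), (if HalfWindingAt s i then 1 else 0)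

end RevolvingWalk

namespace RevolvingWalk

/-! ### Coin sequences and finite averages -/

/-- The step of a walk encoded by a coin toss. -/
def coinStep (b : Bool) : ℤ := if b then 1 else -1

/-- The walk driven by a sequence of coin tosses. -/
def walk (x : ℕ → Bool) (n : ℕ) : ℤ := ∑ k ∈ Finset.range n, coinStep (x k)

/-- Prepend a coin toss to a sequence. -/
def coinCons (b : Bool) (x : ℕ → Bool) : ℕ → Bool
  | 0 => b
  | n + 1 => x n

/-- Drop the first `a` tosses. -/
def coinShift (a : ℕ) (x : ℕ → Bool) : ℕ → Bool := fun k => x (a + k)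

/-- The average of `F` over the first `n` coin tosses (the later tosses being set to `false`). -/
noncomputable def avg : ℕ → ((ℕ → Bool) → ℝ) → ℝ
  | 0, F => F (fun _ => false)
  | n + 1, F => (avg n (fun x => F (coinCons true x)) + avg n (fun x => F (coinCons false x))) / 2

/-- `F` depends on the first `n` tosses only. -/
def IsLocal {α : Type*} (n : ℕ) (F : (ℕ → Bool) → α) : Prop :=
  ∀ x y : ℕ → Bool, (∀ k < n, x k = y k) → F x = F y

lemma IsLocal.mono {α : Type*} {n m : ℕ} {F : (ℕ → Bool) → α} (h : IsLocal n F) (hnm : n ≤ m) :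
    IsLocal m F := fun x y hxy => h x y fun k hk => hxy k (hk.trans_le hnm)

lemma IsLocal.cons {α : Type*} {n : ℕ} {F : (ℕ → Bool) → α} (h : IsLocal (n + 1) F) (b : Bool) :
    IsLocal n (fun x => F (coinCons b x)) := by
  intro x y hxy
  apply h
  intro k hk
  cases k with
  | zero => rfl
  | succ k => exact hxy k (by omega)

lemma coinShift_succ_cons (a : ℕ) (b : Bool) (x : ℕ → Bool) :
    coinShift (a + 1) (coinCons b x) = coinShift a x := by
  funext k
  simp only [coinShift, show a + 1 + k = (a + k) + 1 by omega, coinCons]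

lemma coinShift_zero (x : ℕ → Bool) : coinShift 0 x = x := by
  funext k
  simp [coinShift]

lemma avg_add (n : ℕ) (F G : (ℕ → Bool) → ℝ) :
    avg n (fun x => F x + G x) = avg n F + avg n G := by
  induction n generalizing F G with
  | zero => rfl
  | succ n ih => simp only [avg, ih]; ring

lemma avg_mul_left (n : ℕ) (c : ℝ) (F : (ℕ → Bool) → ℝ) :
    avg n (fun x => c * F x) = c * avg n F := by
  induction n generalizing F with
  | zero => rfl
  | succ n ih => simp only [avg, ih]; ring

lemma avg_const (n : ℕ) (c : ℝ) : avg n (fun _ => c) = c := by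
  induction n with
  | zero => rfl
  | succ n ih => simp only [avg, ih]; ring

lemma avg_sum {ι : Type*} (n : ℕ) (s : Finset ι) (F : ι → (ℕ → Bool) → ℝ) :
    avg n (fun x => ∑ i ∈ s, F i x) = ∑ i ∈ s, avg n (F i) := by
  classical
  induction s using Finset.induction_on with
  | empty => simp [avg_const]
  | insert i s hi ih => simp only [Finset.sum_insert hi, avg_add, ih]

lemma avg_mono (n : ℕ) {F G : (ℕ → Bool) → ℝ} (h : ∀ x, F x ≤ G x) : avg n F ≤ avg n G := by
  induction n generalizing F G with
  | zero => exact h _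
  | succ n ih =>
    have h1 := ih (fun x => h (coinCons true x))
    have h2 := ih (fun x => h (coinCons false x))
    simp only [avg]
    linarith

lemma avg_eq_of_isLocal {n m : ℕ} {F : (ℕ → Bool) → ℝ} (h : IsLocal n F) (hnm : n ≤ m) :
    avg m F = avg n F := by
  induction n generalizing m F with
  | zero =>
    have : F = fun _ => F (fun _ => false) := by
      funext x
      exact h _ _ (by simp)
    rw [this, avg_const, avg_const]
  | succ n ih =>
    obtain ⟨m, rfl⟩ : ∃ k, m = k + 1 := ⟨m - 1, by omega⟩
    simp only [avg]
    rw [ih (h.cons true) (by omega), ih (h.cons false) (by omega)]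

lemma avg_not (n : ℕ) {F : (ℕ → Bool) → ℝ} (h : IsLocal n F) :
    avg n (fun x => F (fun k => !x k)) = avg n F := by
  induction n generalizing F with
  | zero => exact h _ _ (by simp)
  | succ n ih =>
    have key : ∀ b x, (fun k => !coinCons b x k) = coinCons (!b) (fun k => !x k) := by
      intro b x
      funext k
      cases k <;> rfl
    simp only [avg, key, Bool.not_true, Bool.not_false]
    rw [ih (h.cons false), ih (h.cons true), add_comm]

lemma avg_mul_shift (a m : ℕ) {F : (ℕ → Bool) → ℝ} (G : (ℕ → Bool) → ℝ) (h : IsLocal a F) :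
    avg (a + m) (fun x => F x * G (coinShift a x)) = avg a F * avg m G := by
  induction a generalizing F with
  | zero =>
    have : ∀ x, F x = F (fun _ => false) := fun x => h _ _ (by simp)
    rw [Nat.zero_add]
    simp only [coinShift_zero, avg]
    rw [← avg_mul_left]
    congr 1
    funext x
    rw [this x]
  | succ a ih =>
    rw [show a + 1 + m = (a + m) + 1 by omega]
    simp only [avg, coinShift_succ_cons]
    rw [ih (h.cons true), ih (h.cons false)]
    ring

open Classical in
/-- The probability of the event `p` for `n` coin tosses. -/
noncomputable def prob (n : ℕ) (p : (ℕ → Bool) → Prop) : ℝ :=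
  avg n (fun x => if p x then 1 else 0)

lemma prob_mono (n : ℕ) {p q : (ℕ → Bool) → Prop} (h : ∀ x, p x → q x) : prob n p ≤ prob n q := by
  classical
  refine avg_mono n fun x => ?_
  by_cases hp : p x
  · simp [hp, h x hp]
  · simp only [hp, if_false]; split_ifs <;> norm_num

lemma prob_congr (n : ℕ) {p q : (ℕ → Bool) → Prop} (h : ∀ x, p x ↔ q x) : prob n p = prob n q :=
  le_antisymm (prob_mono n fun x => (h x).1) (prob_mono n fun x => (h x).2)

lemma prob_false (n : ℕ) {p : (ℕ → Bool) → Prop} (h : ∀ x, ¬ p x) : prob n p = 0 := by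
  simp [prob, h, avg_const]

lemma prob_true (n : ℕ) {p : (ℕ → Bool) → Prop} (h : ∀ x, p x) : prob n p = 1 := by
  simp [prob, h, avg_const]

lemma prob_of_isLocal {n m : ℕ} {p : (ℕ → Bool) → Prop} (h : IsLocal n p) (hnm : n ≤ m) :
    prob m p = prob n p := by
  classical
  refine avg_eq_of_isLocal (fun x y hxy => ?_) hnm
  simp only [h x y hxy]

lemma prob_not (n : ℕ) {p : (ℕ → Bool) → Prop} (h : IsLocal n p) :
    prob n (fun x => p (fun k => !x k)) = prob n p := by
  classical
  unfold prob
  refine avg_not n (F := fun x => if p x then 1 else 0) (fun x y hxy => ?_)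
  simp only [h x y hxy]

lemma prob_and_shift (a m : ℕ) {p : (ℕ → Bool) → Prop} (q : (ℕ → Bool) → Prop) (h : IsLocal a p) :
    prob (a + m) (fun x => p x ∧ q (coinShift a x)) = prob a p * prob m q := by
  classical
  unfold prob
  rw [← avg_mul_shift a m (F := fun x => if p x then 1 else 0)]
  · congr 1
    funext x
    by_cases h1 : p x <;> by_cases h2 : q (coinShift a x) <;> simp [h1, h2]
  · intro x y hxy
    simp only [h x y hxy]

lemma prob_exists_le {ι : Type*} (n : ℕ) (s : Finset ι) (p : ι → (ℕ → Bool) → Prop) :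
    prob n (fun x => ∃ i ∈ s, p i x) ≤ ∑ i ∈ s, prob n (p i) := by
  classical
  unfold prob
  rw [← avg_sum]
  refine avg_mono n fun x => ?_
  have h0 : ∀ i ∈ s, (0 : ℝ) ≤ if p i x then 1 else 0 := fun i _ => by split_ifs <;> norm_num
  split_ifs with h
  · obtain ⟨i, hi, hp⟩ := h
    have := Finset.single_le_sum h0 hi
    simpa [hp] using this
  · exact Finset.sum_nonneg h0

lemma prob_exists {ι : Type*} (n : ℕ) (s : Finset ι) (p : ι → (ℕ → Bool) → Prop)
    (huniq : ∀ x, ∀ i ∈ s, ∀ j ∈ s, p i x → p j x → i = j) :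
    prob n (fun x => ∃ i ∈ s, p i x) = ∑ i ∈ s, prob n (p i) := by
  classical
  unfold prob
  rw [← avg_sum]
  congr 1
  funext x
  split_ifs with h
  · obtain ⟨i, hi, hp⟩ := h
    rw [Finset.sum_eq_single_of_mem i hi]
    · simp [hp]
    · intro j hj hji
      rw [if_neg]
      exact fun hpj => hji (huniq x j hj i hi hpj hp)
  · push Not at h
    rw [Finset.sum_eq_zero]
    intro i hi
    simp [h i hi]

/-! ### Paths, excursions and half windings -/

/-- `s` starts an excursion of length `2 l` away from `0` with the sign `σ` at time `0`. -/
def Exc (s : ℕ → ℤ) (σ : ℤ) (l : ℕ) : Prop :=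
  s (2 * l) = 0 ∧ ∀ k, 0 < k → k < 2 * l → 0 < σ * s k

lemma coinStep_eq (b : Bool) : coinStep b = 1 ∨ coinStep b = -1 := by
  cases b <;> simp [coinStep]

lemma walk_zero (x : ℕ → Bool) : walk x 0 = 0 := by simp [walk]

lemma walk_succ (x : ℕ → Bool) (n : ℕ) : walk x (n + 1) = walk x n + coinStep (x n) := by
  simp [walk, Finset.sum_range_succ]

lemma walk_coinShift (a : ℕ) (x : ℕ → Bool) (k : ℕ) :
    walk (coinShift a x) k = walk x (a + k) - walk x a := by
  simp [walk, coinShift, Finset.sum_range_add]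

lemma walk_coinShift_of_zero {a : ℕ} {x : ℕ → Bool} (h : walk x a = 0) (k : ℕ) :
    walk (coinShift a x) k = walk x (a + k) := by
  rw [walk_coinShift, h, sub_zero]

lemma coinShift_add (a b : ℕ) (x : ℕ → Bool) :
    coinShift (a + b) x = coinShift b (coinShift a x) := by
  funext k
  simp [coinShift, add_assoc]

lemma walk_congr {x y : ℕ → Bool} {n : ℕ} (h : ∀ k < n, x k = y k) {m : ℕ} (hm : m ≤ n) :
    walk x m = walk y m := by
  refine Finset.sum_congr rfl fun k hk => ?_
  rw [h k ((Finset.mem_range.1 hk).trans_le hm)]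

lemma walk_not (x : ℕ → Bool) (n : ℕ) : walk (fun k => !x k) n = -walk x n := by
  rw [walk, walk, ← Finset.sum_neg_distrib]
  refine Finset.sum_congr rfl fun k _ => ?_
  cases x k <;> simp [coinStep]

lemma walk_coinCons (b : Bool) (x : ℕ → Bool) (n : ℕ) :
    walk (coinCons b x) (n + 1) = coinStep b + walk x n := by
  rw [walk, Finset.sum_range_succ', add_comm]
  rfl

lemma two_dvd_walk_sub (x : ℕ → Bool) (n : ℕ) : (2 : ℤ) ∣ walk x n - n := by
  induction n with
  | zero => simp [walk_zero]
  | succ n ih =>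
    rw [walk_succ]
    push_cast
    rcases coinStep_eq (x n) with h | h <;> rw [h] <;> omega

lemma abs_walk_le (x : ℕ → Bool) (n : ℕ) : |walk x n| ≤ n := by
  induction n with
  | zero => simp [walk_zero]
  | succ n ih =>
    rw [walk_succ]
    push_cast
    rw [abs_le] at *
    rcases coinStep_eq (x n) with h | h <;> rw [h] <;> constructor <;> omega

lemma timeProcess_congr {s r : ℕ → ℤ} {n : ℕ} (h : ∀ k ≤ n, s k = r k) :
    timeProcess s n = timeProcess r n := by
  unfold timeProcess
  refine Finset.sum_congr rfl fun k hk => ?_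
  have hk := Finset.mem_range.1 hk
  have e1 : EdgeAbove s k ↔ EdgeAbove r k := by
    simp only [EdgeAbove, h k hk.le, h (k + 1) hk]
  have e2 : EdgeBelow s k ↔ EdgeBelow r k := by
    simp only [EdgeBelow, h k hk.le, h (k + 1) hk]
  rw [propext e1, propext e2]

lemma timeProcess_add {x : ℕ → Bool} {a : ℕ} (h : walk x a = 0) (b : ℕ) :
    timeProcess (walk x) (a + b) =
      timeProcess (walk x) a + timeProcess (walk (coinShift a x)) b := by
  unfold timeProcess
  rw [Finset.sum_range_add]
  congr 1
  simp only [EdgeAbove, EdgeBelow, walk_coinShift_of_zero h, add_assoc]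

lemma timeProcess_of_exc {x : ℕ → Bool} {σ : ℤ} (hσ : σ = 1 ∨ σ = -1) {l : ℕ}
    (h : Exc (walk x) σ l) : timeProcess (walk x) (2 * l) = 2 * σ * l := by
  classical
  have hedge : ∀ k ∈ Finset.range (2 * l), ((if EdgeAbove (walk x) k then 1 else 0) -
      (if EdgeBelow (walk x) k then 1 else 0) : ℤ) = σ := by
    intro k hk
    have hk := Finset.mem_range.1 hk
    have h0 := walk_zero x
    have hs := walk_succ x k
    have hs' := coinStep_eq (x k)
    have h1 : k = 0 ∨ 0 < σ * walk x k := by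
      rcases Nat.eq_zero_or_pos k with h' | h'
      · exact Or.inl h'
      · exact Or.inr (h.2 k h' hk)
    have h2 : k + 1 = 2 * l ∨ 0 < σ * walk x (k + 1) := by
      rcases Nat.lt_or_ge (k + 1) (2 * l) with h' | h'
      · exact Or.inr (h.2 _ (by omega) h')
      · exact Or.inl (by omega)
    have hl := h.1
    unfold EdgeAbove EdgeBelow
    rcases h1 with rfl | h1 <;> rcases h2 with h2 | h2
    · omega
    · rcases hσ with rfl | rfl <;> split_ifs <;> omega
    · rw [h2, hl] at *
      rcases hσ with rfl | rfl <;> split_ifs <;> omega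
    · rcases hσ with rfl | rfl <;> split_ifs <;> omega
  unfold timeProcess
  rw [Finset.sum_congr rfl hedge]
  simp
  ring

lemma lastZero_eq_of_exc {x : ℕ → Bool} {i t : ℕ} (ht : t < i) (h0 : walk x (2 * t) = 0) {σ : ℤ}
    (h : Exc (walk (coinShift (2 * t) x)) σ (i - t)) : lastZero (walk x) i = t := by
  unfold lastZero
  apply IsGreatest.csSup_eq
  refine ⟨⟨ht, h0⟩, ?_⟩
  rintro r ⟨hr, hr0⟩
  by_contra hlt
  push Not at hlt
  have := h.2 (2 * r - 2 * t) (by omega) (by omega)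
  rw [walk_coinShift_of_zero h0, show 2 * t + (2 * r - 2 * t) = 2 * r by omega, hr0] at this
  simp at this

lemma exc_of_ne_zero {x : ℕ → Bool} {l : ℕ} (h0 : walk x (2 * l) = 0)
    (h : ∀ k, 0 < k → k < 2 * l → walk x k ≠ 0) : Exc (walk x) (coinStep (x 0)) l := by
  refine ⟨h0, fun k hk => ?_⟩
  induction k with
  | zero => omega
  | succ k ih =>
    intro hkl
    have hne := h _ hk hkl
    have hs := walk_succ x k
    rcases Nat.eq_zero_or_pos k with rfl | hk'
    · rw [walk_zero] at hs
      rw [hs]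
      rcases coinStep_eq (x 0) with h' | h' <;> rw [h'] <;> norm_num
    · have := ih hk' (by omega)
      rcases coinStep_eq (x 0) with h' | h' <;> rw [h'] at this ⊢ <;>
      rcases coinStep_eq (x k) with h'' | h'' <;> rw [h''] at hs <;> omega

lemma exists_exc {x : ℕ → Bool} {i : ℕ} (hi : 0 < i) (h : walk x (2 * i) = 0) :
    ∃ t < i, walk x (2 * t) = 0 ∧
      ∃ σ : ℤ, (σ = 1 ∨ σ = -1) ∧ Exc (walk (coinShift (2 * t) x)) σ (i - t) := by
  have hne : {t : ℕ | t < i ∧ walk x (2 * t) = 0}.Nonempty := ⟨0, hi, walk_zero x⟩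
  have hbdd : BddAbove {t : ℕ | t < i ∧ walk x (2 * t) = 0} := ⟨i, fun t ht => ht.1.le⟩
  have hmem := Nat.sSup_mem hne hbdd
  set t := sSup {t : ℕ | t < i ∧ walk x (2 * t) = 0} with ht
  obtain ⟨hti, ht0⟩ := hmem
  refine ⟨t, hti, ht0, _, coinStep_eq _, exc_of_ne_zero ?_ ?_⟩
  · rw [walk_coinShift_of_zero ht0, show 2 * t + 2 * (i - t) = 2 * i by omega, h]
  · intro k hk hkl hz
    rw [walk_coinShift_of_zero ht0] at hz
    have hpar := two_dvd_walk_sub x (2 * t + k)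
    rw [hz] at hpar
    have hmem : (2 * t + k) / 2 ∈ {t : ℕ | t < i ∧ walk x (2 * t) = 0} := by
      refine ⟨by omega, ?_⟩
      rw [show 2 * ((2 * t + k) / 2) = 2 * t + k by omega, hz]
    have := le_csSup hbdd hmem
    omega

lemma exc_sign_unique {x : ℕ → Bool} {l : ℕ} (hl : 0 < l) {σ τ : ℤ} (hσ : σ = 1 ∨ σ = -1)
    (hτ : τ = 1 ∨ τ = -1) (h : Exc (walk x) σ l) (h' : Exc (walk x) τ l) : σ = τ := by
  have h1 := h.2 1 (by omega) (by omega)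
  have h2 := h'.2 1 (by omega) (by omega)
  rcases hσ with rfl | rfl <;> rcases hτ with rfl | rfl <;> omega

/-- The walk is at `0` at time `2 t`, the time process then equals `2 z`, and an excursion
of length `2 (l + 1)` with the sign `σ` follows. -/
def ExcAfter (x : ℕ → Bool) (t : ℕ) (z : ℤ) (l : ℕ) (σ : ℤ) : Prop :=
  (walk x (2 * t) = 0 ∧ timeProcess (walk x) (2 * t) = 2 * z) ∧
    Exc (walk (coinShift (2 * t) x)) σ (l + 1)

/-- The sign of an excursion that leads from the half-line of `y` to the other one. -/
def oppSign (y : ℤ) : ℤ := if 0 < y then -1 else 1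

lemma oppSign_eq (y : ℤ) : oppSign y = 1 ∨ oppSign y = -1 := by
  unfold oppSign; split_ifs <;> simp

/-- The possible values of (half) the time process at a zero of the walk at time `2 t` from
which an excursion of length `2 (l + 1)` can complete a half winding, where the time process
is shifted by `2 c`. -/
noncomputable def crossSet (c : ℤ) (t l : ℕ) : Finset ℤ :=
  (Finset.Icc (-(t : ℤ)) t).filter fun z => (2 : ℤ) ∣ z - t ∧ c + z ≠ 0 ∧ |c + z| ≤ l

/-- The process with the time process shifted by `2 c` completes a half winding at step
`2 (m + 1)`. -/
def CrossAt (c : ℤ) (m : ℕ) (x : ℕ → Bool) : Prop :=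
  ∃ t ∈ Finset.range (m + 1), ∃ z ∈ crossSet c t (m - t),
    ExcAfter x t z (m - t) (oppSign (c + z))

lemma ExcAfter.walk_eq_zero {x : ℕ → Bool} {t : ℕ} {z : ℤ} {l : ℕ} {σ : ℤ}
    (h : ExcAfter x t z l σ) : walk x (2 * (t + l + 1)) = 0 := by
  have := h.2.1
  rwa [walk_coinShift_of_zero h.1.1, show 2 * t + 2 * (l + 1) = 2 * (t + l + 1) by omega] at this

lemma ExcAfter.timeProcess_eq {x : ℕ → Bool} {t : ℕ} {z : ℤ} {l : ℕ} {σ : ℤ}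
    (h : ExcAfter x t z l σ) (hσ : σ = 1 ∨ σ = -1) :
    timeProcess (walk x) (2 * (t + l + 1)) = 2 * (z + σ * (l + 1)) := by
  rw [show 2 * (t + l + 1) = 2 * t + 2 * (l + 1) by omega, timeProcess_add h.1.1,
    timeProcess_of_exc hσ h.2, h.1.2]
  push_cast
  ring

/-- At a zero of the walk, half the time process is an integer `z` with `|z| ≤ t` and `z ≡ t`
modulo `2`. -/
lemma exists_timeProcess_eq (x : ℕ → Bool) (t : ℕ) (h : walk x (2 * t) = 0) :
    ∃ z : ℤ, |z| ≤ t ∧ (2 : ℤ) ∣ z - t ∧ timeProcess (walk x) (2 * t) = 2 * z := by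
  induction t using Nat.strong_induction_on with
  | _ t ih =>
    rcases Nat.eq_zero_or_pos t with rfl | ht
    · exact ⟨0, by simp [timeProcess]⟩
    · obtain ⟨r, hr, hr0, σ, hσ, he⟩ := exists_exc ht h
      obtain ⟨z, hz, hz2, hzt⟩ := ih r hr hr0
      have he' : ExcAfter x r z (t - r - 1) σ :=
        ⟨⟨hr0, hzt⟩, by rwa [show t - r - 1 + 1 = t - r by omega]⟩
      have := he'.timeProcess_eq hσ
      rw [show r + (t - r - 1) + 1 = t by omega] at this
      have hc : ((t - r - 1 : ℕ) : ℤ) = t - r - 1 := by omega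
      rw [hc] at this
      rw [abs_le] at hz
      refine ⟨_, ?_, ?_, this⟩
      · rw [abs_le]
        rcases hσ with rfl | rfl <;> constructor <;> omega
      · rcases hσ with rfl | rfl <;> omega

lemma halfWindingAt_iff (x : ℕ → Bool) (m : ℕ) :
    HalfWindingAt (walk x) (m + 1) ↔ CrossAt 0 m x := by
  constructor
  · rintro ⟨h0, -, hneg⟩
    obtain ⟨t, ht, ht0, σ, hσ, he⟩ := exists_exc (Nat.succ_pos m) h0
    rw [lastZero_eq_of_exc ht ht0 he] at hneg
    obtain ⟨z, hz, hz2, hzt⟩ := exists_timeProcess_eq x t ht0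
    have he' : ExcAfter x t z (m - t) σ :=
      ⟨⟨ht0, hzt⟩, by rwa [show m - t + 1 = m + 1 - t by omega]⟩
    have htp := he'.timeProcess_eq hσ
    rw [show t + (m - t) + 1 = m + 1 by omega] at htp
    rw [htp, hzt] at hneg
    have hneg' : z * (z + σ * ((m - t : ℕ) + 1)) < 0 := by
      by_contra hc
      push Not at hc
      nlinarith
    rw [abs_le] at hz
    refine ⟨t, Finset.mem_range.2 ht, z, ?_, ?_⟩
    · simp only [crossSet, Finset.mem_filter, Finset.mem_Icc, zero_add]
      refine ⟨hz, hz2, ?_, ?_⟩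
      · rintro rfl
        simp at hneg'
      · rw [abs_le]
        rcases mul_neg_iff.1 hneg' with ⟨h1, h2⟩ | ⟨h1, h2⟩ <;>
        rcases hσ with rfl | rfl <;> constructor <;> omega
    · have : σ = oppSign (0 + z) := by
        rw [zero_add]
        unfold oppSign
        rcases mul_neg_iff.1 hneg' with ⟨h1, h2⟩ | ⟨h1, h2⟩ <;>
        rcases hσ with rfl | rfl <;> split_ifs <;> omega
      rwa [← this]
  · rintro ⟨t, ht, z, hz, he⟩
    have ht := Finset.mem_range.1 ht
    simp only [crossSet, Finset.mem_filter, Finset.mem_Icc, zero_add] at hz he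
    obtain ⟨hz1, hz2, hz3, hz4⟩ := hz
    have h0 := he.walk_eq_zero
    have htp := he.timeProcess_eq (oppSign_eq z)
    rw [show t + (m - t) + 1 = m + 1 by omega] at h0 htp
    have hlast : lastZero (walk x) (m + 1) = t :=
      lastZero_eq_of_exc (σ := oppSign z) (by omega) he.1.1
        (by rw [show m + 1 - t = m - t + 1 by omega]; exact he.2)
    refine ⟨h0, ?_, ?_⟩
    · rw [hlast]
      exact he.1.1
    · rw [hlast, htp, he.1.2]
      rw [abs_le] at hz4
      unfold oppSign
      split_ifs with hpos
      · apply mul_neg_of_pos_of_neg <;> omega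
      · apply mul_neg_of_neg_of_pos <;> omega

lemma ExcAfter.unique {x : ℕ → Bool} {m t t' : ℕ} {z z' : ℤ} {σ σ' : ℤ} (ht : t ≤ m)
    (ht' : t' ≤ m) (h : ExcAfter x t z (m - t) σ) (h' : ExcAfter x t' z' (m - t') σ') :
    t = t' ∧ z = z' := by
  have h1 : lastZero (walk x) (m + 1) = t :=
    lastZero_eq_of_exc (by omega) h.1.1 (by rw [show m + 1 - t = m - t + 1 by omega]; exact h.2)
  have h2 : lastZero (walk x) (m + 1) = t' :=
    lastZero_eq_of_exc (by omega) h'.1.1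
      (by rw [show m + 1 - t' = m - t' + 1 by omega]; exact h'.2)
  have h3 : t = t' := h1.symm.trans h2
  subst h3
  refine ⟨rfl, ?_⟩
  have := h.1.2.symm.trans h'.1.2
  omega

/-- A half winding at step `2 (i + 1 + m + 1)` is a half winding at step `2 (m + 1)` of the walk
after a zero at time `2 (i + 1)`. -/
lemma CrossAt.shift {x : ℕ → Bool} {i m : ℕ} {c : ℤ} (h0 : walk x (2 * (i + 1)) = 0)
    (hc : timeProcess (walk x) (2 * (i + 1)) = 2 * c) (h : CrossAt 0 (i + 1 + m) x) :
    CrossAt c m (coinShift (2 * (i + 1)) x) := by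
  obtain ⟨t, ht, z, hz, he⟩ := h
  have ht := Finset.mem_range.1 ht
  have hit : i + 1 ≤ t := by
    by_contra hlt
    push Not at hlt
    have := he.2.2 (2 * (i + 1) - 2 * t) (by omega) (by omega)
    rw [walk_coinShift_of_zero he.1.1,
      show 2 * t + (2 * (i + 1) - 2 * t) = 2 * (i + 1) by omega, h0] at this
    simp at this
  obtain ⟨r, rfl⟩ : ∃ r, t = i + 1 + r := ⟨t - (i + 1), by omega⟩
  have hr0 : walk (coinShift (2 * (i + 1)) x) (2 * r) = 0 := by
    rw [walk_coinShift_of_zero h0, ← mul_add]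
    exact he.1.1
  have hadd := timeProcess_add h0 (2 * r)
  rw [← mul_add, he.1.2, hc] at hadd
  obtain ⟨w, hw, hw2, hwt⟩ := exists_timeProcess_eq _ r hr0
  rw [hwt] at hadd
  obtain rfl : z = c + w := by omega
  simp only [crossSet, Finset.mem_filter, Finset.mem_Icc, zero_add] at hz he
  rw [show i + 1 + m - (i + 1 + r) = m - r by omega] at he hz
  refine ⟨r, Finset.mem_range.2 (by omega), w, ?_, ⟨hr0, hwt⟩, ?_⟩
  · simp only [crossSet, Finset.mem_filter, Finset.mem_Icc]
    exact ⟨abs_le.1 hw, hw2, hz.2.2.1, hz.2.2.2⟩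
  · rw [← coinShift_add, ← mul_add]
    exact he.2

lemma isLocal_excAfter (t : ℕ) (z : ℤ) (l : ℕ) (σ : ℤ) :
    IsLocal (2 * (t + l + 1)) (fun x => ExcAfter x t z l σ) := by
  intro x y hxy
  have hw : ∀ m ≤ 2 * (t + l + 1), walk x m = walk y m := fun m hm => walk_congr hxy hm
  have hT : timeProcess (walk x) (2 * t) = timeProcess (walk y) (2 * t) :=
    timeProcess_congr fun k hk => hw k (by omega)
  have hsh : ∀ k ≤ 2 * (l + 1), walk (coinShift (2 * t) x) k = walk (coinShift (2 * t) y) k := by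
    intro k hk
    rw [walk_coinShift, walk_coinShift, hw _ (by omega), hw _ (by omega)]
  have hE : Exc (walk (coinShift (2 * t) x)) σ (l + 1) ↔
      Exc (walk (coinShift (2 * t) y)) σ (l + 1) := by
    unfold Exc
    rw [hsh _ le_rfl]
    refine and_congr_right fun _ => forall_congr' fun k => forall_congr' fun _ => ?_
    refine forall_congr' fun hk => ?_
    rw [hsh k hk.le]
  simp only [ExcAfter, hw (2 * t) (by omega), hT, hE]

lemma isLocal_crossAt (c : ℤ) (m : ℕ) : IsLocal (2 * (m + 1)) (CrossAt c m) := by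
  intro x y hxy
  unfold CrossAt
  refine propext (exists_congr fun t => and_congr_right fun ht => exists_congr fun z =>
    and_congr_right fun _ => ?_)
  have ht := Finset.mem_range.1 ht
  exact iff_of_eq (isLocal_excAfter t z (m - t) _ x y
    (by rwa [show t + (m - t) + 1 = m + 1 by omega]))

/-! ### Return probabilities and the Chung–Feller theorem -/

/-- The probability that a simple random walk is at `0` at time `2 k`. -/
noncomputable def returnProb (k : ℕ) : ℝ := (k.centralBinom : ℝ) / 4 ^ k

/-- The probability that the first return of a simple random walk to `0` is at time
`2 (k + 1)`. -/
noncomputable def firstReturnProb (k : ℕ) : ℝ := (catalan k : ℝ) / (2 * 4 ^ k)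

lemma catalan_succ_eq_sum_range (n : ℕ) :
    catalan (n + 1) = ∑ k ∈ Finset.range (n + 1), catalan k * catalan (n - k) := by
  rw [catalan_succ', Finset.Nat.sum_antidiagonal_eq_sum_range_succ (fun a b => catalan a * catalan b)]

lemma sum_centralBinom_mul_catalan (n : ℕ) :
    2 * ∑ k ∈ Finset.range (n + 1), k.centralBinom * catalan (n - k) = (n + 1).centralBinom := by
  have h1 : ∑ k ∈ Finset.range (n + 1), k.centralBinom * catalan (n - k) =
      ∑ k ∈ Finset.range (n + 1), (n - k + 1) * (catalan k * catalan (n - k)) := by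
    rw [← Finset.sum_range_reflect]
    refine Finset.sum_congr rfl fun k hk => ?_
    have hk := Finset.mem_range.1 hk
    rw [show n + 1 - 1 - k = n - k by omega, show n - (n - k) = k by omega,
      ← succ_mul_catalan_eq_centralBinom]
    ring
  have h2 : ∑ k ∈ Finset.range (n + 1), k.centralBinom * catalan (n - k) =
      ∑ k ∈ Finset.range (n + 1), (k + 1) * (catalan k * catalan (n - k)) := by
    refine Finset.sum_congr rfl fun k _ => ?_
    rw [← succ_mul_catalan_eq_centralBinom]
    ring
  rw [two_mul]
  nth_rw 1 [h1]
  rw [h2, ← Finset.sum_add_distrib, ← succ_mul_catalan_eq_centralBinom, catalan_succ_eq_sum_range,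
    Finset.mul_sum]
  refine Finset.sum_congr rfl fun k hk => ?_
  have hk := Finset.mem_range.1 hk
  rw [← add_mul]
  congr 1
  omega

lemma returnProb_zero : returnProb 0 = 1 := by simp [returnProb]

lemma sum_returnProb_mul_firstReturnProb (n : ℕ) :
    ∑ k ∈ Finset.range (n + 1), returnProb k * firstReturnProb (n - k) = returnProb (n + 1) := by
  have h : ((2 * ∑ k ∈ Finset.range (n + 1), k.centralBinom * catalan (n - k) : ℕ) : ℝ) =
      (n + 1).centralBinom := by rw [sum_centralBinom_mul_catalan]
  push_cast at h
  rw [returnProb, ← h, Finset.mul_sum, Finset.sum_div]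
  refine Finset.sum_congr rfl fun k hk => ?_
  have hk := Finset.mem_range.1 hk
  obtain ⟨r, rfl⟩ : ∃ r, n = k + r := ⟨n - k, by omega⟩
  rw [returnProb, firstReturnProb, Nat.add_sub_cancel_left, pow_succ, pow_add]
  field_simp
  norm_num

lemma prob_walk_eq (n j : ℕ) :
    prob n (fun x => walk x n = 2 * j - n) = (n.choose j : ℝ) / 2 ^ n := by
  induction n generalizing j with
  | zero =>
    cases j with
    | zero => rw [prob_true _ (by simp [walk_zero])]; simp
    | succ j => rw [prob_false _ (by simp [walk_zero]; omega)]; simp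
  | succ n ih =>
    have hstep : prob (n + 1) (fun x => walk x (n + 1) = 2 * j - (n + 1 : ℕ)) =
        (prob n (fun x => walk x n = 2 * j - n - 2) + prob n (fun x => walk x n = 2 * j - n)) / 2 := by
      have e1 := prob_congr n (p := fun x => walk (coinCons true x) (n + 1) = 2 * j - (n + 1 : ℕ))
        (q := fun x => walk x n = 2 * j - n - 2) (fun x => by
          rw [walk_coinCons, show coinStep true = 1 from rfl]; push_cast; omega)
      have e2 := prob_congr n (p := fun x => walk (coinCons false x) (n + 1) = 2 * j - (n + 1 : ℕ))
        (q := fun x => walk x n = 2 * j - n) (fun x => by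
          rw [walk_coinCons, show coinStep false = -1 from rfl]; push_cast; omega)
      rw [← e1, ← e2]
      rfl
    rw [hstep, ih]
    cases j with
    | zero =>
      rw [prob_false]
      · simp; ring
      · intro x hx
        have := abs_walk_le x n
        rw [abs_le] at this
        push_cast at hx
        omega
    | succ j =>
      rw [prob_congr n (q := fun x => walk x n = 2 * (j : ℕ) - n) (fun x => by push_cast; omega), ih,
        Nat.choose_succ_succ]
      push_cast
      ring

lemma prob_walk_eq_zero (t : ℕ) : prob (2 * t) (fun x => walk x (2 * t) = 0) = returnProb t := by
  rw [prob_congr _ (q := fun x => walk x (2 * t) = 2 * t - (2 * t : ℕ)) (fun x => by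
    push_cast; rw [sub_self]), prob_walk_eq, returnProb, Nat.centralBinom, pow_mul]
  norm_num

lemma isLocal_walk_eq_zero (t : ℕ) : IsLocal (2 * t) (fun x => walk x (2 * t) = 0) := by
  intro x y hxy
  simp only [walk_congr hxy le_rfl]

lemma isLocal_exc (σ : ℤ) (l : ℕ) : IsLocal (2 * l) (fun x => Exc (walk x) σ l) := by
  intro x y hxy
  simp only [Exc, walk_congr hxy le_rfl]
  refine propext (and_congr_right fun _ => forall_congr' fun k => forall_congr' fun _ => ?_)
  refine forall_congr' fun hk => ?_
  rw [walk_congr hxy hk.le]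

lemma prob_exc_neg (l : ℕ) : prob (2 * l) (fun x => Exc (walk x) (-1) l) =
    prob (2 * l) (fun x => Exc (walk x) 1 l) := by
  rw [← prob_not _ (isLocal_exc 1 l)]
  refine prob_congr _ fun x => ?_
  simp [Exc, walk_not]

lemma returnProb_succ_eq_sum_prob_exc (n : ℕ) :
    returnProb (n + 1) = ∑ k ∈ Finset.range (n + 1), returnProb k *
      (2 * prob (2 * (n - k + 1)) (fun x => Exc (walk x) 1 (n - k + 1))) := by
  classical
  have key : ∀ x, walk x (2 * (n + 1)) = 0 ↔ ∃ i ∈ Finset.range (n + 1) ×ˢ ({1, -1} : Finset ℤ),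
      walk x (2 * i.1) = 0 ∧ Exc (walk (coinShift (2 * i.1) x)) i.2 (n - i.1 + 1) := by
    intro x
    constructor
    · intro h
      obtain ⟨t, ht, h0, σ, hσ, he⟩ := exists_exc (Nat.succ_pos n) h
      refine ⟨(t, σ), ?_, h0, by rwa [show n - t + 1 = n + 1 - t by omega]⟩
      simp [hσ]
      omega
    · rintro ⟨⟨t, σ⟩, hi, h0, he⟩
      simp only [Finset.mem_product, Finset.mem_range] at hi
      have := he.1
      rwa [walk_coinShift_of_zero h0, show 2 * t + 2 * (n - t + 1) = 2 * (n + 1) by omega] at this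
  rw [← prob_walk_eq_zero, prob_congr _ key, prob_exists, Finset.sum_product]
  · refine Finset.sum_congr rfl fun k hk => ?_
    have hk := Finset.mem_range.1 hk
    have hp : ∀ σ : ℤ, prob (2 * (n + 1)) (fun x => walk x (2 * k) = 0 ∧
        Exc (walk (coinShift (2 * k) x)) σ (n - k + 1)) =
        returnProb k * prob (2 * (n - k + 1)) (fun x => Exc (walk x) σ (n - k + 1)) := by
      intro σ
      rw [← prob_walk_eq_zero, ← prob_and_shift _ _ _ (isLocal_walk_eq_zero k)]
      congr 1
      omega
    rw [Finset.sum_pair (by norm_num), hp, hp, prob_exc_neg]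
    ring
  · rintro x ⟨t, σ⟩ hi ⟨t', σ'⟩ hi' ⟨h0, he⟩ ⟨h0', he'⟩
    simp only [Finset.mem_product, Finset.mem_range, Finset.mem_insert, Finset.mem_singleton]
      at hi hi' h0 he h0' he'
    have h1 : lastZero (walk x) (n + 1) = t := lastZero_eq_of_exc (by omega) h0
      (by rw [show n + 1 - t = n - t + 1 by omega]; exact he)
    have h2 : lastZero (walk x) (n + 1) = t' := lastZero_eq_of_exc (by omega) h0'
      (by rw [show n + 1 - t' = n - t' + 1 by omega]; exact he')
    have h3 : t = t' := h1.symm.trans h2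
    subst h3
    rw [exc_sign_unique (Nat.succ_pos _) hi.2 hi'.2 he he']

lemma prob_exc (l : ℕ) {σ : ℤ} (hσ : σ = 1 ∨ σ = -1) :
    prob (2 * (l + 1)) (fun x => Exc (walk x) σ (l + 1)) = firstReturnProb l / 2 := by
  have hpos : prob (2 * (l + 1)) (fun x => Exc (walk x) 1 (l + 1)) = firstReturnProb l / 2 := by
    induction l using Nat.strong_induction_on with
    | _ n ih =>
      have h1 := returnProb_succ_eq_sum_prob_exc n
      rw [← sum_returnProb_mul_firstReturnProb, Finset.sum_range_succ', Finset.sum_range_succ',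
        Finset.sum_congr rfl (g := fun k => returnProb (k + 1) *
          (2 * prob (2 * (n - (k + 1) + 1)) (fun x => Exc (walk x) 1 (n - (k + 1) + 1)))),
        add_right_inj, returnProb_zero, one_mul, one_mul] at h1
      · simp only [Nat.sub_zero] at h1
        linarith
      · intro k hk
        have hk := Finset.mem_range.1 hk
        rw [ih (n - (k + 1)) (by omega)]
        ring
  rcases hσ with rfl | rfl
  · exact hpos
  · rw [prob_exc_neg, hpos]

lemma isLocal_walk_timeProcess (t : ℕ) (z : ℤ) : IsLocal (2 * t)
    (fun x => walk x (2 * t) = 0 ∧ timeProcess (walk x) (2 * t) = 2 * z) := by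
  intro x y hxy
  have : timeProcess (walk x) (2 * t) = timeProcess (walk y) (2 * t) :=
    timeProcess_congr fun k hk => walk_congr hxy hk
  simp only [walk_congr hxy le_rfl, this]

lemma prob_excAfter_eq_mul (t : ℕ) (z : ℤ) (l : ℕ) {σ : ℤ} (hσ : σ = 1 ∨ σ = -1) :
    prob (2 * (t + l + 1)) (fun x => ExcAfter x t z l σ) =
      prob (2 * t) (fun x => walk x (2 * t) = 0 ∧ timeProcess (walk x) (2 * t) = 2 * z) *
        (firstReturnProb l / 2) := by
  rw [← prob_exc l hσ, ← prob_and_shift _ _ _ (isLocal_walk_timeProcess t z)]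
  rw [show 2 * t + 2 * (l + 1) = 2 * (t + l + 1) by ring]
  rfl

lemma prob_timeProcess_succ (n : ℕ) (z : ℤ) :
    prob (2 * (n + 1)) (fun x => walk x (2 * (n + 1)) = 0 ∧
        timeProcess (walk x) (2 * (n + 1)) = 2 * z) =
      ∑ k ∈ Finset.range (n + 1), ∑ σ ∈ ({1, -1} : Finset ℤ), prob (2 * k) (fun x =>
        walk x (2 * k) = 0 ∧ timeProcess (walk x) (2 * k) = 2 * (z - σ * (n - k + 1))) *
          (firstReturnProb (n - k) / 2) := by
  classical
  have key : ∀ x, (walk x (2 * (n + 1)) = 0 ∧ timeProcess (walk x) (2 * (n + 1)) = 2 * z) ↔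
      ∃ i ∈ Finset.range (n + 1) ×ˢ ({1, -1} : Finset ℤ),
        ExcAfter x i.1 (z - i.2 * (n - i.1 + 1)) (n - i.1) i.2 := by
    intro x
    constructor
    · rintro ⟨h, hz⟩
      obtain ⟨t, ht, h0, σ, hσ, he⟩ := exists_exc (Nat.succ_pos n) h
      rw [show n + 1 - t = n - t + 1 by omega] at he
      refine ⟨(t, σ), ?_, ⟨h0, ?_⟩, he⟩
      · simp [hσ]
        omega
      · have := timeProcess_of_exc hσ he
        rw [show 2 * (n + 1) = 2 * t + 2 * (n - t + 1) by omega, timeProcess_add h0, this] at hz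
        push_cast [show t ≤ n by omega] at hz ⊢
        linarith
    · rintro ⟨⟨t, σ⟩, hi, he⟩
      simp only [Finset.mem_product, Finset.mem_range, Finset.mem_insert,
        Finset.mem_singleton] at hi he
      have h1 := he.walk_eq_zero
      have h2 := he.timeProcess_eq hi.2
      rw [show t + (n - t) + 1 = n + 1 by omega] at h1 h2
      refine ⟨h1, ?_⟩
      push_cast [show t ≤ n by omega] at h2
      rw [h2]
      ring
  rw [prob_congr _ key, prob_exists, Finset.sum_product]
  · refine Finset.sum_congr rfl fun k hk => Finset.sum_congr rfl fun σ hσ => ?_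
    have hk := Finset.mem_range.1 hk
    simp only [Finset.mem_insert, Finset.mem_singleton] at hσ
    rw [← prob_excAfter_eq_mul _ _ _ hσ, show k + (n - k) + 1 = n + 1 by omega]
  · rintro x ⟨t, σ⟩ hi ⟨t', σ'⟩ hi' he he'
    simp only [Finset.mem_product, Finset.mem_range, Finset.mem_insert, Finset.mem_singleton]
      at hi hi' he he'
    obtain ⟨rfl, -⟩ := he.unique (by omega) (by omega) he'
    rw [exc_sign_unique (Nat.succ_pos _) hi.2 hi'.2 he.2 he'.2]

/-- The Chung–Feller theorem: given that the walk is at `0` at time `2 t`, half its time process is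
uniform on the integers `z` with `|z| ≤ t` and `z ≡ t` modulo `2`. -/
lemma prob_timeProcess_eq (t : ℕ) {z : ℤ} (hz : |z| ≤ t) (hz2 : (2 : ℤ) ∣ z - t) :
    prob (2 * t) (fun x => walk x (2 * t) = 0 ∧ timeProcess (walk x) (2 * t) = 2 * z) =
      2 * firstReturnProb t := by
  induction t using Nat.strong_induction_on generalizing z with
  | _ t ih =>
    cases t with
    | zero =>
      rw [prob_true]
      · simp [firstReturnProb]
      · intro x
        simp at hz
        simp [walk_zero, timeProcess, hz]
    | succ n =>
      have hind : ∀ k ≤ n, ∀ w : ℤ, (2 : ℤ) ∣ w - k → prob (2 * k) (fun x => walk x (2 * k) = 0 ∧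
          timeProcess (walk x) (2 * k) = 2 * w) =
          if |w| ≤ k then 2 * firstReturnProb k else 0 := by
        intro k hk w hw
        split_ifs with h
        · exact ih k (by omega) h hw
        · refine prob_false _ fun x hx => h ?_
          obtain ⟨w', hw', -, hw2⟩ := exists_timeProcess_eq x k hx.1
          obtain rfl : w = w' := by omega
          exact hw'
      rw [abs_le] at hz
      push_cast at hz hz2
      obtain ⟨q, hq⟩ := hz2
      obtain ⟨j, hj⟩ : ∃ j : ℕ, (j : ℤ) = q + (n + 1) := ⟨(q + (n + 1)).toNat, by omega⟩
      have hjn : j ≤ n + 1 := by omega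
      rw [prob_timeProcess_succ]
      -- the term with a positive last excursion contributes iff `n + 1 - k ≤ j`
      have hterm : ∀ k ∈ Finset.range (n + 1), (∑ σ ∈ ({1, -1} : Finset ℤ), prob (2 * k) (fun x =>
          walk x (2 * k) = 0 ∧ timeProcess (walk x) (2 * k) = 2 * (z - σ * (n - k + 1))) *
          (firstReturnProb (n - k) / 2)) =
          (if n + 1 - j ≤ k then firstReturnProb k * firstReturnProb (n - k) else 0) +
          (if j ≤ k then firstReturnProb k * firstReturnProb (n - k) else 0) := by
        intro k hk
        have hk := Finset.mem_range.1 hk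
        rw [Finset.sum_pair (by norm_num), hind k (by omega) _ (by omega),
          hind k (by omega) _ (by omega)]
        congr 1
        · have : |z - 1 * (n - k + 1)| ≤ k ↔ n + 1 - j ≤ k := by
            rw [abs_le]; omega
          simp only [this]
          split_ifs <;> ring
        · have : |z - -1 * (n - k + 1)| ≤ k ↔ j ≤ k := by
            rw [abs_le]; omega
          simp only [this]
          split_ifs <;> ring
      rw [Finset.sum_congr rfl hterm, Finset.sum_add_distrib, ← Finset.sum_range_reflect,
        ← Finset.sum_add_distrib]
      have hcat : 2 * firstReturnProb (n + 1) = ∑ k ∈ Finset.range (n + 1),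
          firstReturnProb k * firstReturnProb (n - k) := by
        rw [firstReturnProb, catalan_succ_eq_sum_range]
        push_cast
        rw [Finset.sum_div, Finset.mul_sum]
        refine Finset.sum_congr rfl fun k hk => ?_
        have hk := Finset.mem_range.1 hk
        obtain ⟨r, rfl⟩ : ∃ r, n = k + r := ⟨n - k, by omega⟩
        rw [firstReturnProb, firstReturnProb, Nat.add_sub_cancel_left, pow_succ, pow_add]
        field_simp
        ring
      rw [hcat]
      refine Finset.sum_congr rfl fun k hk => ?_
      have hk := Finset.mem_range.1 hk
      rw [show n + 1 - 1 - k = n - k by omega, show n - (n - k) = k by omega,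
        mul_comm (firstReturnProb (n - k))]
      by_cases hjk : j ≤ k
      · rw [if_neg (by omega), if_pos hjk, zero_add]
      · rw [if_pos (by omega), if_neg hjk, add_zero]

lemma prob_excAfter (t : ℕ) {z : ℤ} (hz : |z| ≤ t) (hz2 : (2 : ℤ) ∣ z - t) (l : ℕ) {σ : ℤ}
    (hσ : σ = 1 ∨ σ = -1) : prob (2 * (t + l + 1)) (fun x => ExcAfter x t z l σ) =
      firstReturnProb t * firstReturnProb l := by
  rw [prob_excAfter_eq_mul _ _ _ hσ, prob_timeProcess_eq t hz hz2]
  ring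

/-! ### First and second moments of the number of half windings -/

lemma firstReturnProb_nonneg (k : ℕ) : 0 ≤ firstReturnProb k := by
  unfold firstReturnProb; positivity

lemma returnProb_pos (k : ℕ) : 0 < returnProb k := by
  have := k.centralBinom_pos
  unfold returnProb; positivity

lemma firstReturnProb_eq (k : ℕ) : firstReturnProb k = returnProb k / (2 * (k + 1)) := by
  have h : ((k + 1) * catalan k : ℝ) = k.centralBinom := by
    exact_mod_cast succ_mul_catalan_eq_centralBinom k
  rw [firstReturnProb, returnProb, ← h]
  field_simp

lemma returnProb_succ (k : ℕ) : returnProb (k + 1) = returnProb k * (2 * k + 1) / (2 * k + 2) := by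
  have h : ((k + 1) * (k + 1).centralBinom : ℝ) = 2 * (2 * k + 1) * k.centralBinom := by
    exact_mod_cast Nat.succ_mul_centralBinom_succ k
  rw [returnProb, returnProb, pow_succ]
  field_simp
  linear_combination 2 * h

lemma returnProb_sub_succ (k : ℕ) : returnProb k - returnProb (k + 1) = firstReturnProb k := by
  rw [returnProb_succ, firstReturnProb_eq]
  field_simp
  ring

lemma sum_Ico_firstReturnProb {m n : ℕ} (h : m ≤ n) :
    ∑ k ∈ Finset.Ico m n, firstReturnProb k = returnProb m - returnProb n := by
  induction n, h using Nat.le_induction with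
  | base => simp
  | succ n hmn ih =>
    rw [Finset.sum_Ico_succ_top hmn, ih, ← returnProb_sub_succ]
    ring

lemma returnProb_antitone : Antitone returnProb :=
  antitone_nat_of_succ_le fun k => by
    have := returnProb_sub_succ k
    have := firstReturnProb_nonneg k
    linarith

lemma card_le_of_parity {s : Finset ℤ} {a b p : ℤ} (h : ∀ z ∈ s, a ≤ z ∧ z ≤ b ∧ (2 : ℤ) ∣ z - p) :
    s.card ≤ ((b - a) / 2 + 1).toNat := by
  have hmaps : ∀ z ∈ s, (z - a) / 2 ∈ Finset.Icc 0 ((b - a) / 2) := by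
    intro z hz
    have := h z hz
    rw [Finset.mem_Icc]
    omega
  have := Finset.card_le_card_of_injOn _ hmaps (by
    intro z hz w hw hzw
    have h1 := h z hz
    have h2 := h w hw
    simp only at hzw
    omega)
  simpa using this

lemma card_crossSet_le (c : ℤ) (t l : ℕ) : (crossSet c t l).card ≤ min t l + 1 := by
  have h1 := card_le_of_parity (s := crossSet c t l) (a := -t) (b := t) (p := t) (by
    intro z hz
    simp only [crossSet, Finset.mem_filter, Finset.mem_Icc] at hz
    exact ⟨hz.1.1, hz.1.2, hz.2.1⟩)
  have h2 := card_le_of_parity (s := crossSet c t l) (a := -l - c) (b := l - c) (p := t) (by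
    intro z hz
    simp only [crossSet, Finset.mem_filter, Finset.mem_Icc, abs_le] at hz
    exact ⟨by omega, by omega, hz.2.1⟩)
  omega

lemma crossSet_eq_empty {c : ℤ} {t l : ℕ} (h : ((t + l : ℕ) : ℤ) < |c|) : crossSet c t l = ∅ := by
  rw [Finset.eq_empty_iff_forall_notMem]
  intro z hz
  simp only [crossSet, Finset.mem_filter, Finset.mem_Icc, abs_le] at hz
  rw [lt_abs] at h
  push_cast at h
  omega

lemma le_card_crossSet (t l : ℕ) : min t l ≤ (crossSet 0 t l).card + 1 := by
  rcases Nat.eq_zero_or_pos (min t l) with h0 | hpos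
  · omega
  set m : ℕ := min t l - (t - min t l) % 2 with hm
  have hsub : ((Finset.range (m + 1)).image (fun j : ℕ => (m : ℤ) - 2 * j)).erase 0 ⊆
      crossSet 0 t l := by
    intro z hz
    simp only [Finset.mem_erase, Finset.mem_image, Finset.mem_range] at hz
    obtain ⟨hz0, j, hj, rfl⟩ := hz
    simp only [crossSet, Finset.mem_filter, Finset.mem_Icc, abs_le, zero_add]
    refine ⟨⟨by omega, by omega⟩, by omega, hz0, by omega, by omega⟩
  have hcard := Finset.card_le_card hsub
  have herase := Finset.pred_card_le_card_erase (a := (0 : ℤ))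
    (s := (Finset.range (m + 1)).image (fun j : ℕ => (m : ℤ) - 2 * j))
  rw [Finset.card_image_of_injective _ (fun i j hij => by
    have : (m : ℤ) - 2 * i = m - 2 * j := hij
    omega),
    Finset.card_range] at herase
  omega

/-- The uniform bound for the probability of a half winding at step `2 (m + 1)`, whatever the
initial value of the time process. -/
noncomputable def crossBound (m : ℕ) : ℝ :=
  ∑ t ∈ Finset.range (m + 1),
    firstReturnProb t * firstReturnProb (m - t) * ((min t (m - t) : ℕ) + 1)

lemma crossBound_nonneg (m : ℕ) : 0 ≤ crossBound m :=
  Finset.sum_nonneg fun t _ => mul_nonneg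
    (mul_nonneg (firstReturnProb_nonneg _) (firstReturnProb_nonneg _)) (by positivity)

lemma prob_crossAt (c : ℤ) (m : ℕ) : prob (2 * (m + 1)) (CrossAt c m) =
    ∑ t ∈ Finset.range (m + 1),
      firstReturnProb t * firstReturnProb (m - t) * (crossSet c t (m - t)).card := by
  unfold CrossAt
  rw [prob_exists]
  · refine Finset.sum_congr rfl fun t ht => ?_
    have ht := Finset.mem_range.1 ht
    rw [prob_exists]
    · rw [Finset.sum_congr rfl (g := fun _ => firstReturnProb t * firstReturnProb (m - t))]
      · simp [mul_comm]
      · intro z hz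
        simp only [crossSet, Finset.mem_filter, Finset.mem_Icc] at hz
        rw [← prob_excAfter t (abs_le.2 hz.1) hz.2.1 (m - t) (oppSign_eq (c + z)),
          show t + (m - t) + 1 = m + 1 by omega]
    · intro x z _ z' _ h h'
      exact (h.unique (by omega) (by omega) h').2
  · rintro x t ht t' ht' ⟨z, _, h⟩ ⟨z', _, h'⟩
    have ht := Finset.mem_range.1 ht
    have ht' := Finset.mem_range.1 ht'
    exact (h.unique (by omega) (by omega) h').1

lemma prob_crossAt_le (c : ℤ) (m : ℕ) :
    prob (2 * (m + 1)) (CrossAt c m) ≤ if |c| ≤ m then crossBound m else 0 := by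
  rw [prob_crossAt]
  split_ifs with h
  · refine Finset.sum_le_sum fun t _ => mul_le_mul_of_nonneg_left ?_
      (mul_nonneg (firstReturnProb_nonneg _) (firstReturnProb_nonneg _))
    exact_mod_cast card_crossSet_le c t (m - t)
  · refine (Finset.sum_eq_zero fun t ht => ?_).le
    have ht := Finset.mem_range.1 ht
    rw [crossSet_eq_empty (by push Not at h; rwa [show t + (m - t) = m by omega])]
    simp

/-- The values `z` in `crossSet 0 t l` for which the time process after the excursion, `2 c`,
satisfies `|c| ≤ m`. -/
noncomputable def closeSet (t l m : ℕ) : Finset ℤ :=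
  (crossSet 0 t l).filter fun z => |z + oppSign z * (l + 1)| ≤ m

lemma card_closeSet_le (t l m : ℕ) : (closeSet t l m).card ≤ min t l + 1 :=
  (Finset.card_filter_le _ _).trans (card_crossSet_le 0 t l)

lemma card_closeSet_le_ite (t l m : ℕ) :
    (closeSet t l m).card ≤ if l < t + m then 2 * min l m else 0 := by
  have hmem : ∀ z ∈ closeSet t l m, |z| ≤ t ∧ |z| ≤ l ∧ z ≠ 0 ∧ (l : ℤ) + 1 - |z| ≤ m := by
    intro z hz
    simp only [closeSet, crossSet, Finset.mem_filter, Finset.mem_Icc, zero_add] at hz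
    obtain ⟨⟨h1, -, h3, h4⟩, h5⟩ := hz
    refine ⟨abs_le.2 h1, h4, h3, ?_⟩
    unfold oppSign at h5
    rw [abs_le] at h5
    rcases abs_cases z with ⟨h6, h7⟩ | ⟨h6, h7⟩ <;> split_ifs at h5 <;> omega
  split_ifs with h
  · have hsub : closeSet t l m ⊆ Finset.Icc (max 1 ((l : ℤ) + 1 - m)) l ∪
        Finset.Icc (-(l : ℤ)) (-(max 1 ((l : ℤ) + 1 - m))) := by
      intro z hz
      obtain ⟨h1, h2, h3, h4⟩ := hmem z hz
      simp only [Finset.mem_union, Finset.mem_Icc]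
      rcases abs_cases z with ⟨h6, h7⟩ | ⟨h6, h7⟩ <;> omega
    have := (Finset.card_le_card hsub).trans (Finset.card_union_le _ _)
    simp only [Int.card_Icc] at this
    omega
  · rw [Nat.le_zero, Finset.card_eq_zero, Finset.eq_empty_iff_forall_notMem]
    intro z hz
    obtain ⟨h1, h2, h3, h4⟩ := hmem z hz
    omega

lemma prob_crossAt_and_crossAt_le (i m : ℕ) :
    prob (2 * (i + 1 + m + 1)) (fun x => CrossAt 0 i x ∧ CrossAt 0 (i + 1 + m) x) ≤
      crossBound m * ∑ t ∈ Finset.range (i + 1),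
        firstReturnProb t * firstReturnProb (i - t) * (closeSet t (i - t) m).card := by
  have h1 : ∀ x, CrossAt 0 i x ∧ CrossAt 0 (i + 1 + m) x → ∃ t ∈ Finset.range (i + 1),
      ∃ z ∈ crossSet 0 t (i - t), ExcAfter x t z (i - t) (oppSign z) ∧
        CrossAt (z + oppSign z * ((i - t : ℕ) + 1)) m (coinShift (2 * (i + 1)) x) := by
    rintro x ⟨⟨t, ht, z, hz, he⟩, hc⟩
    have ht' := Finset.mem_range.1 ht
    rw [zero_add] at he
    have h0 := he.walk_eq_zero
    have hT := he.timeProcess_eq (oppSign_eq z)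
    rw [show t + (i - t) + 1 = i + 1 by omega] at h0 hT
    exact ⟨t, ht, z, hz, he, hc.shift h0 hT⟩
  refine (prob_mono _ h1).trans ((prob_exists_le _ _ _).trans ?_)
  rw [Finset.mul_sum]
  refine Finset.sum_le_sum fun t ht => ?_
  have ht := Finset.mem_range.1 ht
  refine (prob_exists_le _ _ _).trans ?_
  have h2 : ∀ z ∈ crossSet 0 t (i - t), prob (2 * (i + 1 + m + 1)) (fun x =>
      ExcAfter x t z (i - t) (oppSign z) ∧
        CrossAt (z + oppSign z * ((i - t : ℕ) + 1)) m (coinShift (2 * (i + 1)) x)) ≤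
      if |z + oppSign z * ((i - t : ℕ) + 1)| ≤ m then
        firstReturnProb t * firstReturnProb (i - t) * crossBound m else 0 := by
    intro z hz
    simp only [crossSet, Finset.mem_filter, Finset.mem_Icc] at hz
    have hloc := isLocal_excAfter t z (i - t) (oppSign z)
    have hp := prob_excAfter t (abs_le.2 hz.1) hz.2.1 (i - t) (oppSign_eq z)
    rw [show t + (i - t) + 1 = i + 1 by omega] at hloc hp
    rw [show 2 * (i + 1 + m + 1) = 2 * (i + 1) + 2 * (m + 1) by ring,
      prob_and_shift _ _ _ hloc, hp, ← mul_ite_zero]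
    exact mul_le_mul_of_nonneg_left (prob_crossAt_le _ _)
      (mul_nonneg (firstReturnProb_nonneg _) (firstReturnProb_nonneg _))
  refine (Finset.sum_le_sum h2).trans_eq ?_
  rw [← Finset.sum_filter, Finset.sum_const, nsmul_eq_mul, closeSet]
  ring

lemma sum_range_sum_range_le {f : ℕ → ℕ → ℝ} (hf : ∀ i j, 0 ≤ f i j) (n : ℕ) :
    ∑ m ∈ Finset.range n, ∑ t ∈ Finset.range (m + 1), f t (m - t) ≤
      ∑ i ∈ Finset.range n, ∑ j ∈ Finset.range n, f i j := by
  rw [Finset.sum_range_diag_flip]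
  refine Finset.sum_le_sum fun i _ => Finset.sum_le_sum_of_subset_of_nonneg ?_ fun j _ _ => hf i j
  exact Finset.range_subset_range.2 (Nat.sub_le _ _)

lemma sum_range_sum_range_pred_le {f : ℕ → ℕ → ℝ} (hf : ∀ i j, 0 ≤ f i j) (n : ℕ) :
    ∑ j ∈ Finset.range n, ∑ i ∈ Finset.range j, f i (j - 1 - i) ≤
      ∑ i ∈ Finset.range n, ∑ m ∈ Finset.range n, f i m := by
  refine le_trans ?_ (sum_range_sum_range_le hf n)
  cases n with
  | zero => simp
  | succ n =>
    rw [Finset.sum_range_succ', Finset.sum_range_succ]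
    simp only [Finset.range_zero, Finset.sum_empty, Nat.add_sub_cancel, add_zero]
    exact le_add_of_nonneg_right (Finset.sum_nonneg fun i _ => hf _ _)

open Classical in
/-- The number of half windings completed up to step `2 n`. -/
noncomputable def crossCount (n : ℕ) (x : ℕ → Bool) : ℝ :=
  ∑ m ∈ Finset.range n, if CrossAt 0 m x then 1 else 0

lemma isLocal_crossCount (n : ℕ) : IsLocal (2 * n) (crossCount n) := by
  intro x y hxy
  refine Finset.sum_congr rfl fun m hm => ?_
  have hm := Finset.mem_range.1 hm
  rw [isLocal_crossAt 0 m x y fun k hk => hxy k (by omega)]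

lemma le_avg_crossCount (n : ℕ) :
    ∑ m ∈ Finset.range n, crossBound m - 2 ≤ avg (2 * n) (crossCount n) := by
  have h1 : avg (2 * n) (crossCount n) = ∑ m ∈ Finset.range n, prob (2 * (m + 1)) (CrossAt 0 m) := by
    unfold crossCount
    rw [avg_sum]
    refine Finset.sum_congr rfl fun m hm => ?_
    have hm := Finset.mem_range.1 hm
    exact prob_of_isLocal (isLocal_crossAt 0 m) (by omega)
  have h2 : ∀ m ∈ Finset.range n, crossBound m - 2 * ∑ t ∈ Finset.range (m + 1),
      firstReturnProb t * firstReturnProb (m - t) ≤ prob (2 * (m + 1)) (CrossAt 0 m) := by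
    intro m _
    rw [prob_crossAt, crossBound, Finset.mul_sum, ← Finset.sum_sub_distrib]
    refine Finset.sum_le_sum fun t _ => ?_
    have hc : ((min t (m - t) : ℕ) : ℝ) ≤ (crossSet 0 t (m - t)).card + 1 := by
      exact_mod_cast le_card_crossSet t (m - t)
    have := mul_le_mul_of_nonneg_left hc
      (mul_nonneg (firstReturnProb_nonneg t) (firstReturnProb_nonneg (m - t)))
    linarith
  have h3 := sum_range_sum_range_le (f := fun i j => firstReturnProb i * firstReturnProb j)
    (fun i j => mul_nonneg (firstReturnProb_nonneg _) (firstReturnProb_nonneg _)) n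
  have h4 : ∑ k ∈ Finset.range n, firstReturnProb k ≤ 1 := by
    rw [Finset.range_eq_Ico, sum_Ico_firstReturnProb (Nat.zero_le n), returnProb_zero]
    linarith [returnProb_pos n]
  have h5 : 0 ≤ ∑ k ∈ Finset.range n, firstReturnProb k :=
    Finset.sum_nonneg fun k _ => firstReturnProb_nonneg k
  rw [← Finset.sum_mul_sum] at h3
  have h6 := Finset.sum_le_sum h2
  rw [Finset.sum_sub_distrib, ← Finset.mul_sum] at h6
  rw [h1]
  nlinarith

/-- The weight of the pairs of half windings that are close to each other. -/
noncomputable def closeBound (n : ℕ) : ℝ :=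
  ∑ m ∈ Finset.range n, ∑ l ∈ Finset.range n,
    crossBound m * (firstReturnProb l * (2 * (min l m : ℕ)) * returnProb ((l - m) + (m - l)))

lemma sum_firstReturnProb_ite_le (l m n : ℕ) :
    ∑ t ∈ Finset.range n, firstReturnProb t * (if l < t + m ∧ m ≤ t + l then 1 else 0) ≤
      returnProb ((l - m) + (m - l)) := by
  set r := (l - m) + (m - l) with hr
  have h1 : ∑ t ∈ Finset.range n, firstReturnProb t * (if l < t + m ∧ m ≤ t + l then 1 else 0) ≤
      ∑ t ∈ Finset.Ico r (max r n), firstReturnProb t := by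
    simp only [mul_ite, mul_one, mul_zero]
    rw [← Finset.sum_filter]
    refine Finset.sum_le_sum_of_subset_of_nonneg ?_ fun t _ _ => firstReturnProb_nonneg t
    intro t ht
    simp only [Finset.mem_filter, Finset.mem_range] at ht
    rw [Finset.mem_Ico]
    exact ⟨by omega, lt_max_of_lt_right ht.1⟩
  rw [sum_Ico_firstReturnProb (le_max_left _ _)] at h1
  linarith [returnProb_pos (max r n)]

lemma sum_close_pairs_le (n : ℕ) :
    ∑ i ∈ Finset.range n, ∑ m ∈ Finset.range n, (if m ≤ i then crossBound m *
      ∑ t ∈ Finset.range (i + 1),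
        firstReturnProb t * firstReturnProb (i - t) * (closeSet t (i - t) m).card else 0) ≤
      closeBound n := by
  rw [Finset.sum_comm]
  refine Finset.sum_le_sum fun m _ => ?_
  set f : ℕ → ℕ → ℝ := fun t l => crossBound m * (firstReturnProb l * (2 * (min l m : ℕ)) *
    (firstReturnProb t * (if l < t + m ∧ m ≤ t + l then 1 else 0))) with hf
  have hf0 : ∀ t l, 0 ≤ f t l := by
    intro t l
    have h1 := firstReturnProb_nonneg l
    have h2 := firstReturnProb_nonneg t
    have h3 := crossBound_nonneg m
    simp only [hf]
    split_ifs <;> positivity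
  have h1 : ∀ i ∈ Finset.range n, (if m ≤ i then crossBound m * ∑ t ∈ Finset.range (i + 1),
        firstReturnProb t * firstReturnProb (i - t) * (closeSet t (i - t) m).card else 0) ≤
      ∑ t ∈ Finset.range (i + 1), f t (i - t) := by
    intro i _
    split_ifs with hmi
    · rw [Finset.mul_sum]
      refine Finset.sum_le_sum fun t ht => ?_
      have ht := Finset.mem_range.1 ht
      have hc : ((closeSet t (i - t) m).card : ℝ) ≤
          2 * (min (i - t) m : ℕ) * (if i - t < t + m ∧ m ≤ t + (i - t) then 1 else 0) := by
        have := card_closeSet_le_ite t (i - t) m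
        have hm : m ≤ t + (i - t) := by omega
        simp only [hm, and_true]
        split_ifs at this ⊢
        · rw [mul_one]; exact_mod_cast this
        · rw [mul_zero]; exact_mod_cast this
      have := mul_le_mul_of_nonneg_left hc (mul_nonneg (crossBound_nonneg m)
        (mul_nonneg (firstReturnProb_nonneg t) (firstReturnProb_nonneg (i - t))))
      simp only [hf]
      calc _ = _ := by ring
        _ ≤ _ := this
        _ = _ := by ring
    · exact Finset.sum_nonneg fun t _ => hf0 _ _
  refine (Finset.sum_le_sum h1).trans ((sum_range_sum_range_le hf0 n).trans ?_)
  rw [Finset.sum_comm]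
  refine Finset.sum_le_sum fun l _ => ?_
  simp only [hf]
  rw [← Finset.mul_sum, ← Finset.mul_sum]
  refine mul_le_mul_of_nonneg_left (mul_le_mul_of_nonneg_left (sum_firstReturnProb_ite_le l m n) ?_)
    (crossBound_nonneg m)
  have := firstReturnProb_nonneg l
  positivity

lemma two_mul_sum_lt_le_sq (a : ℕ → ℝ) (ha : ∀ i, 0 ≤ a i) (n : ℕ) :
    2 * ∑ i ∈ Finset.range n, ∑ m ∈ Finset.range n, (if i < m then a m * a i else 0) ≤
      (∑ i ∈ Finset.range n, a i) ^ 2 := by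
  have hcomm : ∑ i ∈ Finset.range n, ∑ m ∈ Finset.range n, (if i < m then a m * a i else 0) =
      ∑ i ∈ Finset.range n, ∑ m ∈ Finset.range n, (if m < i then a m * a i else 0) := by
    rw [Finset.sum_comm]
    refine Finset.sum_congr rfl fun i _ => Finset.sum_congr rfl fun m _ => ?_
    rw [mul_comm]
  rw [two_mul]
  nth_rw 2 [hcomm]
  rw [← Finset.sum_add_distrib, sq, Finset.sum_mul_sum]
  refine Finset.sum_le_sum fun i _ => ?_
  rw [← Finset.sum_add_distrib]
  refine Finset.sum_le_sum fun m _ => ?_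
  have := mul_nonneg (ha i) (ha m)
  split_ifs <;> first | omega | nlinarith

lemma avg_crossCount_sq_le (n : ℕ) : avg (2 * n) (fun x => crossCount n x ^ 2) ≤
    ∑ m ∈ Finset.range n, crossBound m + (∑ m ∈ Finset.range n, crossBound m) ^ 2 +
      2 * closeBound n := by
  classical
  set J : ℕ → ℕ → ℝ := fun i m => ∑ t ∈ Finset.range (i + 1),
        firstReturnProb t * firstReturnProb (i - t) * (closeSet t (i - t) m).card with hJ
  have hJ0 : ∀ i m, 0 ≤ J i m := fun i m => Finset.sum_nonneg fun t _ => mul_nonneg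
    (mul_nonneg (firstReturnProb_nonneg _) (firstReturnProb_nonneg _)) (by positivity)
  have hJle : ∀ i m, J i m ≤ crossBound i := by
    intro i m
    refine Finset.sum_le_sum fun t _ => mul_le_mul_of_nonneg_left ?_
      (mul_nonneg (firstReturnProb_nonneg _) (firstReturnProb_nonneg _))
    exact_mod_cast card_closeSet_le t (i - t) m
  have hsq : ∀ (k : ℕ) (x : ℕ → Bool), crossCount k x ^ 2 = ∑ j ∈ Finset.range k,
      ((if CrossAt 0 j x then 1 else 0) +
        2 * ∑ i ∈ Finset.range j, (if CrossAt 0 i x ∧ CrossAt 0 j x then 1 else 0)) := by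
    intro k x
    induction k with
    | zero => simp [crossCount]
    | succ k ih =>
      rw [Finset.sum_range_succ, ← ih]
      have h1 : crossCount (k + 1) x = crossCount k x + (if CrossAt 0 k x then 1 else 0) :=
        Finset.sum_range_succ _ _
      rw [h1]
      have h2 : ∑ i ∈ Finset.range k, (if CrossAt 0 i x ∧ CrossAt 0 k x then (1 : ℝ) else 0) =
          crossCount k x * (if CrossAt 0 k x then 1 else 0) := by
        rw [crossCount, Finset.sum_mul]
        refine Finset.sum_congr rfl fun i _ => ?_
        by_cases h1 : CrossAt 0 i x <;> by_cases h2 : CrossAt 0 k x <;> simp [h1, h2]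
      rw [h2]
      split_ifs <;> ring
  have havg : avg (2 * n) (fun x => crossCount n x ^ 2) = ∑ j ∈ Finset.range n,
      (prob (2 * (j + 1)) (CrossAt 0 j) + 2 * ∑ i ∈ Finset.range j,
        prob (2 * (j + 1)) (fun x => CrossAt 0 i x ∧ CrossAt 0 j x)) := by
    simp only [hsq]
    rw [avg_sum]
    refine Finset.sum_congr rfl fun j hj => ?_
    have hj := Finset.mem_range.1 hj
    rw [avg_add, avg_mul_left, avg_sum]
    congr 1
    · exact prob_of_isLocal (isLocal_crossAt 0 j) (by omega)
    · congr 1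
      refine Finset.sum_congr rfl fun i hi => ?_
      have hi := Finset.mem_range.1 hi
      have hloc : IsLocal (2 * (j + 1)) (fun x => CrossAt 0 i x ∧ CrossAt 0 j x) := by
        intro x y hxy
        beta_reduce
        rw [isLocal_crossAt 0 j x y hxy,
          (isLocal_crossAt 0 i).mono (show 2 * (i + 1) ≤ 2 * (j + 1) by omega) x y hxy]
      rw [← prob_of_isLocal hloc (show 2 * (j + 1) ≤ 2 * n by omega), prob]
      congr 1
      funext x
      congr
  have hpair : ∀ j, ∀ i ∈ Finset.range j,
      prob (2 * (j + 1)) (fun x => CrossAt 0 i x ∧ CrossAt 0 j x) ≤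
        crossBound (j - 1 - i) * J i (j - 1 - i) := by
    intro j i hi
    have hi := Finset.mem_range.1 hi
    obtain ⟨m, rfl⟩ : ∃ m, j = i + 1 + m := ⟨j - (i + 1), by omega⟩
    rw [show i + 1 + m - 1 - i = m by omega]
    exact prob_crossAt_and_crossAt_le i m
  have hsplit : ∀ i m, crossBound m * J i m ≤
      (if i < m then crossBound m * crossBound i else 0) +
        (if m ≤ i then crossBound m * J i m else 0) := by
    intro i m
    by_cases h : i < m
    · rw [if_pos h, if_neg (by omega), add_zero]
      exact mul_le_mul_of_nonneg_left (hJle i m) (crossBound_nonneg m)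
    · rw [if_neg h, if_pos (by omega), zero_add]
  have h1 : ∑ j ∈ Finset.range n, ∑ i ∈ Finset.range j,
        prob (2 * (j + 1)) (fun x => CrossAt 0 i x ∧ CrossAt 0 j x) ≤
      ∑ i ∈ Finset.range n, ∑ m ∈ Finset.range n, crossBound m * J i m :=
    (Finset.sum_le_sum fun j _ => Finset.sum_le_sum (hpair j)).trans
      (sum_range_sum_range_pred_le (f := fun i m => crossBound m * J i m)
        (fun i m => mul_nonneg (crossBound_nonneg m) (hJ0 i m)) n)
  have h2 := Finset.sum_le_sum fun i (_ : i ∈ Finset.range n) =>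
    Finset.sum_le_sum fun m (_ : m ∈ Finset.range n) => hsplit i m
  simp only [Finset.sum_add_distrib] at h2
  have h3 := two_mul_sum_lt_le_sq crossBound crossBound_nonneg n
  have h4 := sum_close_pairs_le n
  have h5 : ∑ j ∈ Finset.range n, prob (2 * (j + 1)) (CrossAt 0 j) ≤
      ∑ m ∈ Finset.range n, crossBound m :=
    Finset.sum_le_sum fun m _ => (prob_crossAt_le 0 m).trans_eq (by simp)
  rw [havg, Finset.sum_add_distrib, ← Finset.mul_sum]
  linarith

lemma avg_crossCount_sub_sq_le (n : ℕ) :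
    avg (2 * n) (fun x => (crossCount n x - ∑ m ∈ Finset.range n, crossBound m) ^ 2) ≤
      5 * ∑ m ∈ Finset.range n, crossBound m + 2 * closeBound n := by
  set A := ∑ m ∈ Finset.range n, crossBound m with hA
  have hA0 : 0 ≤ A := Finset.sum_nonneg fun m _ => crossBound_nonneg m
  have h1 : avg (2 * n) (fun x => (crossCount n x - A) ^ 2) =
      avg (2 * n) (fun x => crossCount n x ^ 2) + (-2 * A) * avg (2 * n) (crossCount n) + A ^ 2 := by
    rw [← avg_mul_left, ← avg_const (2 * n) (A ^ 2), ← avg_add, ← avg_add]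
    congr 1
    funext x
    ring
  have h2 := avg_crossCount_sq_le n
  have h3 := le_avg_crossCount n
  rw [← hA] at h2 h3
  rw [h1]
  nlinarith

/-! ### Logarithmic asymptotics -/

lemma returnProb_sq_mul_le (k : ℕ) : returnProb k ^ 2 * (k + 1) ≤ 1 := by
  induction k with
  | zero => simp [returnProb_zero]
  | succ k ih =>
    have h : ((2 * k + 1) ^ 2 * (k + 2) : ℝ) ≤ (2 * k + 2) ^ 2 * (k + 1) := by
      have : (0 : ℝ) ≤ k := k.cast_nonneg
      nlinarith
    have h2 : returnProb (k + 1) ^ 2 * ((k + 1 : ℕ) + 1) =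
        returnProb k ^ 2 * (((2 * k + 1) ^ 2 * (k + 2)) / (2 * k + 2) ^ 2) := by
      rw [returnProb_succ]
      push_cast
      field_simp
      ring
    rw [h2]
    refine le_trans (mul_le_mul_of_nonneg_left ?_ (sq_nonneg _)) ih
    rw [div_le_iff₀ (by positivity)]
    linarith

lemma returnProb_le_inv_sqrt (k : ℕ) : returnProb k ≤ 1 / √(k + 1) := by
  rw [le_div_iff₀ (by positivity)]
  rw [← sq_le_one_iff₀ (mul_nonneg (returnProb_pos k).le (Real.sqrt_nonneg _)), mul_pow,
    Real.sq_sqrt (by positivity)]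
  exact returnProb_sq_mul_le k

lemma inv_sqrt_le_sub (n : ℕ) : 1 / √((n : ℝ) + 1) ≤ 2 * √(n + 1) - 2 * √n := by
  have h1 : 0 < √((n : ℝ) + 1) := by positivity
  have h2 : 0 ≤ √(n : ℝ) := by positivity
  have h3 : √((n : ℝ) + 1) ^ 2 = n + 1 := Real.sq_sqrt (by positivity)
  have h4 : √(n : ℝ) ^ 2 = n := Real.sq_sqrt (by positivity)
  rw [div_le_iff₀ h1]
  nlinarith [sq_nonneg (√((n : ℝ) + 1) - √n)]

lemma sum_inv_sqrt_le (n : ℕ) : ∑ k ∈ Finset.range n, 1 / √((k : ℝ) + 1) ≤ 2 * √n := by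
  induction n with
  | zero => simp
  | succ n ih =>
    rw [Finset.sum_range_succ]
    have := inv_sqrt_le_sub n
    push_cast
    linarith

lemma sum_Ico_inv_mul_sqrt_le {a b : ℕ} (ha : 0 < a) (hab : a ≤ b) :
    ∑ m ∈ Finset.Ico a b, 1 / (((m : ℝ) + 1) * √(m + 1)) ≤ 2 / √a - 2 / √b := by
  induction b, hab using Nat.le_induction with
  | base => simp
  | succ b hab ih =>
    rw [Finset.sum_Ico_succ_top hab]
    have hb : (0 : ℝ) < b := by exact_mod_cast ha.trans_le hab
    have h1 : 0 < √((b : ℝ) + 1) := by positivity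
    have h2 : 0 < √(b : ℝ) := by positivity
    have h3 : √((b : ℝ) + 1) ^ 2 = b + 1 := Real.sq_sqrt (by positivity)
    have h4 : √(b : ℝ) ^ 2 = b := Real.sq_sqrt (by positivity)
    have h5 := inv_sqrt_le_sub b
    have h6 : √(b : ℝ) ≤ √(b + 1) := Real.sqrt_le_sqrt (by linarith)
    have key : 1 / (((b : ℝ) + 1) * √(b + 1)) ≤ 2 / √b - 2 / √(b + 1) := by
      have e1 : 2 / √(b : ℝ) - 2 / √(b + 1) = (2 * √(b + 1) - 2 * √b) / (√b * √(b + 1)) := by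
        field_simp
      have e2 : 1 / (((b : ℝ) + 1) * √(b + 1)) = (1 / √(b + 1)) / (b + 1) := by
        field_simp
      rw [e1, e2]
      refine div_le_div₀ (le_trans (by positivity) h5) h5 (by positivity) ?_
      nlinarith
    push_cast
    linarith

lemma firstReturnProb_mul_succ (k : ℕ) : firstReturnProb k * (k + 1) = returnProb k / 2 := by
  rw [firstReturnProb_eq]
  field_simp

lemma crossBound_term_le {t s m : ℕ} (hts : t ≤ s) (hm : t + s = m) :
    firstReturnProb t * firstReturnProb s * (t + 1) ≤
      1 / √(t + 1) * (1 / ((m + 1) * √(m + 1))) := by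
  have h1 : firstReturnProb t * (t + 1) ≤ 1 / √(t + 1) / 2 := by
    rw [firstReturnProb_mul_succ]
    linarith [returnProb_le_inv_sqrt t]
  have hs : (m : ℝ) + 1 ≤ 2 * (s + 1) := by
    rw [← hm]
    have : (t : ℝ) ≤ s := by exact_mod_cast hts
    push_cast
    linarith
  have h2 : √((m : ℝ) + 1) ≤ 2 * √(s + 1) := by
    rw [Real.sqrt_le_left (by positivity), mul_pow, Real.sq_sqrt (by positivity)]
    have : (0 : ℝ) ≤ s := s.cast_nonneg
    linarith
  have h3 : firstReturnProb s ≤ 2 * (1 / ((m + 1) * √(m + 1))) := by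
    rw [firstReturnProb_eq]
    have := returnProb_le_inv_sqrt s
    calc returnProb s / (2 * (s + 1)) ≤ (1 / √(s + 1)) / (2 * (s + 1)) := by gcongr
      _ = 2 * (1 / ((2 * (s + 1)) * (2 * √(s + 1)))) := by field_simp
      _ ≤ _ := by gcongr
  calc firstReturnProb t * firstReturnProb s * (t + 1)
      = (firstReturnProb t * (t + 1)) * firstReturnProb s := by ring
    _ ≤ (1 / √(t + 1) / 2) * (2 * (1 / ((m + 1) * √(m + 1)))) :=
        mul_le_mul h1 h3 (firstReturnProb_nonneg _) (by positivity)
    _ = _ := by ring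

lemma crossBound_le (m : ℕ) : crossBound m ≤ 4 / (m + 1) := by
  have hterm : ∀ t ∈ Finset.range (m + 1),
      firstReturnProb t * firstReturnProb (m - t) * ((min t (m - t) : ℕ) + 1) ≤
        (1 / √((t : ℝ) + 1) + 1 / √(((m - t : ℕ) : ℝ) + 1)) * (1 / ((m + 1) * √(m + 1))) := by
    intro t ht
    have ht := Finset.mem_range.1 ht
    rw [add_mul]
    rcases le_total t (m - t) with h | h
    · rw [min_eq_left h]
      refine (crossBound_term_le h (m := m) (by omega)).trans (le_add_of_nonneg_right (by positivity))
    · rw [min_eq_right h, mul_comm (firstReturnProb t)]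
      refine (crossBound_term_le h (m := m) (by omega)).trans (le_add_of_nonneg_left (by positivity))
  refine (Finset.sum_le_sum hterm).trans ?_
  rw [← Finset.sum_mul, Finset.sum_add_distrib]
  have h1 := sum_inv_sqrt_le (m + 1)
  have h2 : ∑ t ∈ Finset.range (m + 1), 1 / √(((m - t : ℕ) : ℝ) + 1) =
      ∑ t ∈ Finset.range (m + 1), 1 / √((t : ℝ) + 1) := by
    rw [← Finset.sum_range_reflect]
    refine Finset.sum_congr rfl fun t ht => ?_
    have ht := Finset.mem_range.1 ht
    rw [show m - (m + 1 - 1 - t) = t by omega]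
  rw [h2]
  push_cast at h1
  calc _ ≤ (2 * √((m : ℝ) + 1) + 2 * √(m + 1)) * (1 / ((m + 1) * √(m + 1))) := by gcongr
    _ = 4 / (m + 1) := by field_simp; norm_num

lemma sum_inv_sqrt_dist_le (l : ℕ) :
    ∑ m ∈ Finset.range (l + (l + 1)), 1 / √((((l - m) + (m - l) : ℕ) : ℝ) + 1) ≤ 4 * √(l + 1) := by
  rw [Finset.sum_range_add]
  have h1 : ∑ m ∈ Finset.range l, 1 / √((((l - m) + (m - l) : ℕ) : ℝ) + 1) ≤
      ∑ m ∈ Finset.range l, 1 / √((m : ℝ) + 1) := by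
    rw [← Finset.sum_range_reflect (fun m : ℕ => 1 / √((m : ℝ) + 1))]
    refine Finset.sum_le_sum fun m hm => ?_
    have hm := Finset.mem_range.1 hm
    have : ((l - 1 - m : ℕ) : ℝ) ≤ ((l - m) + (m - l) : ℕ) := by
      exact_mod_cast (by omega)
    gcongr
  have h2 : ∑ m ∈ Finset.range (l + 1), 1 / √((((l - (l + m)) + (l + m - l) : ℕ) : ℝ) + 1) =
      ∑ m ∈ Finset.range (l + 1), 1 / √((m : ℝ) + 1) := by
    refine Finset.sum_congr rfl fun m _ => ?_
    rw [show (l - (l + m)) + (l + m - l) = m by omega]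
  have h3 := sum_inv_sqrt_le l
  have h4 := sum_inv_sqrt_le (l + 1)
  have h5 : √(l : ℝ) ≤ √(l + 1) := Real.sqrt_le_sqrt (by linarith)
  push_cast at h4
  rw [h2]
  linarith

lemma sum_crossBound_mul_returnProb_dist_le (l n : ℕ) :
    ∑ m ∈ Finset.range n, crossBound m * ((min l m : ℕ) * returnProb ((l - m) + (m - l))) ≤
      32 * √(l + 1) := by
  set f : ℕ → ℝ := fun m => crossBound m * ((min l m : ℕ) * returnProb ((l - m) + (m - l))) with hf
  have hf0 : ∀ m, 0 ≤ f m := fun m => mul_nonneg (crossBound_nonneg m)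
    (mul_nonneg (Nat.cast_nonneg _) (returnProb_pos _).le)
  set b := max n (l + (l + 1)) with hb
  have h1 : ∑ m ∈ Finset.range n, f m ≤ ∑ m ∈ Finset.range (l + (l + 1)), f m +
      ∑ m ∈ Finset.Ico (l + (l + 1)) b, f m := by
    rw [Finset.sum_range_add_sum_Ico _ (le_max_right _ _)]
    exact Finset.sum_le_sum_of_subset_of_nonneg
      (Finset.range_subset_range.2 (le_max_left _ _)) fun m _ _ => hf0 m
  have h2 : ∀ m ∈ Finset.range (l + (l + 1)), f m ≤
      4 * (1 / √((((l - m) + (m - l) : ℕ) : ℝ) + 1)) := by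
    intro m _
    have hmin : ((min l m : ℕ) : ℝ) ≤ m + 1 := by
      have : min l m ≤ m + 1 := by omega
      exact_mod_cast this
    calc f m ≤ 4 / (m + 1) * ((m + 1) * (1 / √((((l - m) + (m - l) : ℕ) : ℝ) + 1))) := by
          refine mul_le_mul (crossBound_le m) ?_ (mul_nonneg (Nat.cast_nonneg _)
            (returnProb_pos _).le) (by positivity)
          exact mul_le_mul hmin (returnProb_le_inv_sqrt _) (returnProb_pos _).le (by positivity)
      _ = _ := by field_simp
  have h3 : ∀ m ∈ Finset.Ico (l + (l + 1)) b, f m ≤ 8 * l * (1 / (((m : ℝ) + 1) * √(m + 1))) := by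
    intro m hm
    have hm := Finset.mem_Ico.1 hm
    have hml : ((m : ℝ) + 1) ≤ 4 * (((l - m + (m - l) : ℕ) : ℝ) + 1) := by
      exact_mod_cast (by omega)
    have hs : √((m : ℝ) + 1) ≤ 2 * √(((l - m + (m - l) : ℕ) : ℝ) + 1) := by
      rw [Real.sqrt_le_left (by positivity), mul_pow, Real.sq_sqrt (by positivity)]
      linarith
    calc f m ≤ 4 / (m + 1) * (l * (1 / √((((l - m) + (m - l) : ℕ) : ℝ) + 1))) := by
          refine mul_le_mul (crossBound_le m) ?_ (mul_nonneg (Nat.cast_nonneg _)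
            (returnProb_pos _).le) (by positivity)
          rw [min_eq_left (by omega)]
          exact mul_le_mul_of_nonneg_left (returnProb_le_inv_sqrt _) (by positivity)
      _ = 8 * l * (1 / (((m : ℝ) + 1) * (2 * √((((l - m) + (m - l) : ℕ) : ℝ) + 1)))) := by
          field_simp; ring
      _ ≤ _ := by gcongr
  have h4 := Finset.sum_le_sum h2
  have h5 := Finset.sum_le_sum h3
  rw [← Finset.mul_sum] at h4 h5
  have h6 := sum_inv_sqrt_dist_le l
  have h7 := sum_Ico_inv_mul_sqrt_le (a := l + (l + 1)) (b := b) (by omega) (le_max_right _ _)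
  have h8 : 0 ≤ 2 / √(b : ℝ) := by positivity
  have h9 : (l : ℝ) * (2 / √((l + (l + 1) : ℕ) : ℝ)) ≤ 2 * √(l + 1) := by
    have hl : (0 : ℝ) ≤ l := l.cast_nonneg
    have : √((l : ℝ) + 1) ≤ √((l + (l + 1) : ℕ) : ℝ) := by
      apply Real.sqrt_le_sqrt
      push_cast
      linarith
    calc (l : ℝ) * (2 / √((l + (l + 1) : ℕ) : ℝ)) ≤ (l + 1) * (2 / √((l : ℝ) + 1)) := by
          gcongr
          linarith
      _ = 2 * √(l + 1) := by
          have h : √((l : ℝ) + 1) * √(l + 1) = l + 1 := Real.mul_self_sqrt (by positivity)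
          field_simp
          nlinarith
  have h10 : 8 * (l : ℝ) * ∑ m ∈ Finset.Ico (l + (l + 1)) b, 1 / (((m : ℝ) + 1) * √(m + 1)) ≤
      8 * l * (2 / √((l + (l + 1) : ℕ) : ℝ)) := by
    gcongr
    linarith
  linarith

lemma sum_inv_le_log (n : ℕ) : ∑ k ∈ Finset.range n, 1 / ((k : ℝ) + 1) ≤ 1 + Real.log n := by
  have h := harmonic_le_one_add_log n
  simpa [harmonic] using h

lemma log_le_sum_inv (n : ℕ) : Real.log (n + 1) ≤ ∑ k ∈ Finset.range n, 1 / ((k : ℝ) + 1) := by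
  have h := log_add_one_le_harmonic n
  simpa [harmonic] using h

lemma closeBound_le (n : ℕ) : closeBound n ≤ 32 * (1 + Real.log n) := by
  unfold closeBound
  rw [Finset.sum_comm]
  have h1 : ∀ l ∈ Finset.range n, ∑ m ∈ Finset.range n,
      crossBound m * (firstReturnProb l * (2 * (min l m : ℕ)) * returnProb ((l - m) + (m - l))) ≤
      32 * (1 / ((l : ℝ) + 1)) := by
    intro l _
    have h2 := sum_crossBound_mul_returnProb_dist_le l n
    have h3 := returnProb_le_inv_sqrt l
    calc _ = 2 * firstReturnProb l * ∑ m ∈ Finset.range n,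
          crossBound m * ((min l m : ℕ) * returnProb ((l - m) + (m - l))) := by
          rw [Finset.mul_sum]
          refine Finset.sum_congr rfl fun m _ => ?_
          ring
      _ ≤ 2 * firstReturnProb l * (32 * √(l + 1)) :=
          mul_le_mul_of_nonneg_left h2 (mul_nonneg zero_le_two (firstReturnProb_nonneg l))
      _ = 32 * (returnProb l * √(l + 1)) / (l + 1) := by
          rw [firstReturnProb_eq]
          field_simp
      _ ≤ 32 * (1 / √(l + 1) * √(l + 1)) / (l + 1) := by gcongr
      _ = _ := by field_simp
  refine (Finset.sum_le_sum h1).trans ?_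
  rw [← Finset.mul_sum]
  have := sum_inv_le_log n
  linarith

lemma returnProb_sq_mul_wallis (k : ℕ) : returnProb k ^ 2 * (2 * k + 1) * Real.Wallis.W k = 1 := by
  induction k with
  | zero => simp [returnProb_zero, Real.Wallis.W]
  | succ k ih =>
    refine Eq.trans ?_ ih
    rw [Real.Wallis.W_succ, returnProb_succ]
    push_cast
    field_simp
    ring

lemma le_returnProb_sq (k : ℕ) : 2 / (Real.pi * (2 * k + 1)) ≤ returnProb k ^ 2 := by
  have h1 := returnProb_sq_mul_wallis k
  have h2 := Real.Wallis.W_le k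
  have hpi := Real.pi_pos
  rw [div_le_iff₀ (by positivity)]
  have := mul_le_mul_of_nonneg_left h2 (show 0 ≤ returnProb k ^ 2 * (2 * k + 1) by positivity)
  nlinarith

lemma returnProb_succ_sq_le (k : ℕ) : returnProb (k + 1) ^ 2 ≤ 1 / (Real.pi * (k + 1)) := by
  have h1 := returnProb_sq_mul_wallis (k + 1)
  have h2 := Real.Wallis.le_W (k + 1)
  have hpi := Real.pi_pos
  have h3 := mul_le_mul_of_nonneg_left h2
    (show 0 ≤ returnProb (k + 1) ^ 2 * (2 * (k + 1 : ℕ) + 1) by positivity)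
  rw [h1] at h3
  push_cast at h3
  have h4 : Real.pi * (k + 1) ≤ (2 * ((k : ℝ) + 1) + 1) *
      ((2 * (k + 1) + 1) / (2 * (k + 1) + 2) * (Real.pi / 2)) := by
    have : (2 * ((k : ℝ) + 1) + 1) * ((2 * (k + 1) + 1) / (2 * (k + 1) + 2) * (Real.pi / 2)) =
      Real.pi * ((2 * (k + 1) + 1) ^ 2 / (4 * (k + 2))) := by
      field_simp
      ring
    rw [this]
    refine mul_le_mul_of_nonneg_left ?_ hpi.le
    rw [le_div_iff₀ (by positivity)]
    nlinarith
  rw [le_div_iff₀ (by positivity)]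
  have h5 := mul_le_mul_of_nonneg_left h4 (sq_nonneg (returnProb (k + 1)))
  linarith

/-- The layer cake formula for the weights `min t l + 1`. -/
lemma sum_sum_min_eq (n : ℕ) :
    ∑ t ∈ Finset.range n, ∑ l ∈ Finset.range n,
      firstReturnProb t * firstReturnProb l * ((min t l : ℕ) + 1) =
    ∑ r ∈ Finset.range n, (returnProb r - returnProb n) ^ 2 := by
  have h1 : ∀ r ∈ Finset.range n, (returnProb r - returnProb n) ^ 2 =
      ∑ t ∈ Finset.range n, ∑ l ∈ Finset.range n,
        firstReturnProb t * firstReturnProb l * (if r ≤ t ∧ r ≤ l then 1 else 0) := by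
    intro r hr
    have hr := Finset.mem_range.1 hr
    have h2 : ∑ t ∈ Finset.range n, (if r ≤ t then firstReturnProb t else 0) =
        returnProb r - returnProb n := by
      rw [← sum_Ico_firstReturnProb hr.le, ← Finset.sum_filter]
      refine Finset.sum_congr ?_ fun _ _ => rfl
      ext t
      simp only [Finset.mem_filter, Finset.mem_range, Finset.mem_Ico]
      exact and_comm
    rw [← h2, sq, Finset.sum_mul_sum]
    refine Finset.sum_congr rfl fun t _ => Finset.sum_congr rfl fun l _ => ?_
    by_cases h3 : r ≤ t <;> by_cases h4 : r ≤ l <;> simp [h3, h4]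
  symm
  rw [Finset.sum_congr rfl h1, Finset.sum_comm]
  refine Finset.sum_congr rfl fun t ht => ?_
  rw [Finset.sum_comm]
  refine Finset.sum_congr rfl fun l hl => ?_
  have ht := Finset.mem_range.1 ht
  have hl := Finset.mem_range.1 hl
  rw [← Finset.mul_sum]
  congr 1
  rw [← Finset.sum_filter, Finset.sum_const, nsmul_eq_mul, mul_one]
  have : (Finset.range n).filter (fun r => r ≤ t ∧ r ≤ l) = Finset.range (min t l + 1) := by
    ext r
    simp only [Finset.mem_filter, Finset.mem_range]
    omega
  rw [this, Finset.card_range]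
  push_cast
  rfl

lemma crossWeight_nonneg (t l : ℕ) :
    0 ≤ firstReturnProb t * firstReturnProb l * (((min t l : ℕ) : ℝ) + 1) :=
  mul_nonneg (mul_nonneg (firstReturnProb_nonneg _) (firstReturnProb_nonneg _)) (by positivity)

lemma sum_crossBound_le (n : ℕ) :
    ∑ m ∈ Finset.range n, crossBound m ≤ 1 + (1 + Real.log n) / Real.pi := by
  have hpi := Real.pi_pos
  have h1 := sum_range_sum_range_le crossWeight_nonneg n
  rw [sum_sum_min_eq] at h1
  refine h1.trans ?_
  have h2 : ∀ r ∈ Finset.range n, (returnProb r - returnProb n) ^ 2 ≤ returnProb r ^ 2 := by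
    intro r hr
    have := returnProb_antitone (Finset.mem_range.1 hr).le
    have := returnProb_pos n
    nlinarith
  refine (Finset.sum_le_sum h2).trans ?_
  have h3 : ∑ r ∈ Finset.range n, returnProb r ^ 2 ≤ ∑ r ∈ Finset.range (n + 1), returnProb r ^ 2 :=
    Finset.sum_le_sum_of_subset_of_nonneg (Finset.range_subset_range.2 (Nat.le_succ n))
      fun _ _ _ => sq_nonneg _
  rw [Finset.sum_range_succ', returnProb_zero] at h3
  have h4 := Finset.sum_le_sum fun r (_ : r ∈ Finset.range n) => returnProb_succ_sq_le r
  have h5 : ∑ r ∈ Finset.range n, 1 / (Real.pi * ((r : ℝ) + 1)) =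
      (∑ r ∈ Finset.range n, 1 / ((r : ℝ) + 1)) / Real.pi := by
    rw [Finset.sum_div]
    refine Finset.sum_congr rfl fun r _ => ?_
    field_simp
  rw [h5] at h4
  have h6 := div_le_div_of_nonneg_right (sum_inv_le_log n) hpi.le
  linarith

lemma le_sum_crossBound {n : ℕ} (hn : 0 < n) :
    Real.log n / Real.pi - 5 ≤ ∑ m ∈ Finset.range n, crossBound m := by
  have hpi := Real.pi_pos
  set h := (n + 1) / 2 with hh
  have h1 : ∑ t ∈ Finset.range h, ∑ l ∈ Finset.range h,
      firstReturnProb t * firstReturnProb l * ((min t l : ℕ) + 1) ≤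
      ∑ m ∈ Finset.range n, crossBound m := by
    unfold crossBound
    rw [Finset.sum_range_diag_flip n (fun t l =>
      firstReturnProb t * firstReturnProb l * (((min t l : ℕ) : ℝ) + 1))]
    refine (Finset.sum_le_sum fun t ht => ?_).trans (Finset.sum_le_sum_of_subset_of_nonneg
      (Finset.range_subset_range.2 (show h ≤ n by omega))
      fun t _ _ => Finset.sum_nonneg fun l _ => crossWeight_nonneg t l)
    have ht := Finset.mem_range.1 ht
    exact Finset.sum_le_sum_of_subset_of_nonneg
      (Finset.range_subset_range.2 (show h ≤ n - t by omega)) fun l _ _ => crossWeight_nonneg t l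
  rw [sum_sum_min_eq] at h1
  have h2 : ∀ r ∈ Finset.range h, 1 / ((r : ℝ) + 1) / Real.pi - 2 * returnProb h * (1 / √(r + 1)) ≤
      (returnProb r - returnProb h) ^ 2 := by
    intro r _
    have e1 := le_returnProb_sq r
    have e2 : 1 / ((r : ℝ) + 1) / Real.pi ≤ 2 / (Real.pi * (2 * r + 1)) := by
      rw [div_div, div_le_div_iff₀ (by positivity) (by positivity)]
      nlinarith
    have e3 := mul_le_mul_of_nonneg_left (returnProb_le_inv_sqrt r) (returnProb_pos h).le
    nlinarith [sq_nonneg (returnProb h)]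
  have h3 := Finset.sum_le_sum h2
  rw [Finset.sum_sub_distrib, ← Finset.sum_div, ← Finset.mul_sum] at h3
  have h4 : 2 * returnProb h * ∑ r ∈ Finset.range h, 1 / √((r : ℝ) + 1) ≤ 4 := by
    have e1 : returnProb h ≤ 1 / √(h + 1) := returnProb_le_inv_sqrt h
    have e2 : √(h : ℝ) ≤ √(h + 1) := Real.sqrt_le_sqrt (by linarith)
    calc _ ≤ 2 * (1 / √((h : ℝ) + 1)) * (2 * √(h + 1)) := by
          refine mul_le_mul (by linarith) ((sum_inv_sqrt_le h).trans (by linarith))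
            (Finset.sum_nonneg fun r _ => by positivity) (by positivity)
      _ = 4 := by field_simp; norm_num
  have h5 := div_le_div_of_nonneg_right (log_le_sum_inv h) hpi.le
  have h6 : Real.log n - 1 ≤ Real.log (h + 1) := by
    have hn' : (0 : ℝ) < n := by exact_mod_cast hn
    have e1 : Real.log n ≤ Real.log (2 * (h + 1)) := by
      refine Real.log_le_log hn' ?_
      have : n ≤ 2 * (h + 1) := by omega
      exact_mod_cast this
    rw [Real.log_mul (by norm_num) (by positivity)] at e1
    have := Real.log_two_lt_d9
    linarith
  have h7 : (Real.log n - 1) / Real.pi ≤ Real.log (h + 1) / Real.pi := by gcongr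
  have h8 : 1 / Real.pi ≤ 1 := by
    rw [div_le_one hpi]
    linarith [Real.pi_gt_three]
  rw [sub_div] at h7
  linarith

lemma avg_crossCount_sub_log_sq_le {n : ℕ} (hn : 0 < n) :
    avg (2 * n) (fun x => (crossCount n x - Real.log n / Real.pi) ^ 2) ≤ 300 * (1 + Real.log n) := by
  have hpi := Real.pi_gt_three
  set A := ∑ m ∈ Finset.range n, crossBound m with hA
  set L := Real.log n / Real.pi with hL
  have hlog : 0 ≤ Real.log n := Real.log_natCast_nonneg n
  have h1 : L - 5 ≤ A := le_sum_crossBound hn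
  have h2 : A ≤ 1 + (1 + Real.log n) / Real.pi := sum_crossBound_le n
  have h3 : avg (2 * n) (fun x => (crossCount n x - A) ^ 2) ≤ 5 * A + 2 * closeBound n :=
    avg_crossCount_sub_sq_le n
  have h4 := closeBound_le n
  have hL1 : (1 + Real.log n) / Real.pi = 1 / Real.pi + L := add_div _ _ _
  have hL2 : 1 / Real.pi ≤ 1 := by
    rw [div_le_one (by linarith)]
    linarith
  have hL3 : L ≤ Real.log n := div_le_self hlog (by linarith)
  have h5 : avg (2 * n) (fun x => (crossCount n x - L) ^ 2) ≤
      avg (2 * n) (fun x => 2 * (crossCount n x - A) ^ 2 + 2 * (A - L) ^ 2) := by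
    refine avg_mono _ fun x => ?_
    nlinarith [sq_nonneg (crossCount n x - A - (A - L))]
  rw [avg_add, avg_mul_left, avg_const] at h5
  have h6 : (A - L) ^ 2 ≤ 25 := by nlinarith
  nlinarith

/-! ### Almost sure convergence -/

/-- Extend a finite sequence of tosses by `false`. -/
def coinExtend {n : ℕ} (v : Fin n → Bool) (k : ℕ) : Bool := if h : k < n then v ⟨k, h⟩ else false

lemma coinExtend_cons {n : ℕ} (b : Bool) (v : Fin n → Bool) :
    coinExtend (Fin.cons b v : Fin (n + 1) → Bool) = coinCons b (coinExtend v) := by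
  funext k
  cases k with
  | zero => simp [coinExtend, coinCons]
  | succ k =>
    by_cases h : k < n
    · simp only [coinExtend, coinCons, h, Nat.succ_lt_succ h, dif_pos]
      exact Fin.cons_succ (α := fun _ => Bool) b v ⟨k, h⟩
    · simp [coinExtend, coinCons, h]

lemma avg_eq_sum (n : ℕ) (F : (ℕ → Bool) → ℝ) :
    avg n F = ∑ v : Fin n → Bool, (1 / 2) ^ n * F (coinExtend v) := by
  induction n generalizing F with
  | zero =>
    simp only [avg, pow_zero, one_mul, Finset.univ_unique, Finset.sum_singleton]
    congr 1
  | succ n ih =>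
    have hcons : ∀ b v, Fin.consEquiv (fun _ : Fin (n + 1) => Bool) (b, v) =
      (Fin.cons b v : Fin (n + 1) → Bool) := fun _ _ => rfl
    rw [← (Fin.consEquiv (fun _ : Fin (n + 1) => Bool)).sum_comp, Fintype.sum_prod_type]
    simp only [avg, ih, Fintype.sum_bool, hcons, coinExtend_cons, ← Finset.mul_sum]
    ring

lemma eq_comp_coinExtend {Ω : Type*} {B : ℕ → Ω → Bool} {n : ℕ} {F : (ℕ → Bool) → ℝ} (hF : IsLocal n F) :
    (fun ω => F (fun k => B k ω)) =
      (fun v : Fin n → Bool => F (coinExtend v)) ∘ (fun ω (i : Fin n) => B i ω) := by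
  funext ω
  refine hF _ _ fun k hk => ?_
  simp [coinExtend, hk]

lemma crossCount_mono (x : ℕ → Bool) : Monotone (fun n => crossCount n x) := by
  intro m n hmn
  refine Finset.sum_le_sum_of_subset_of_nonneg (Finset.range_subset_range.2 hmn) fun _ _ _ => ?_
  split_ifs <;> norm_num

lemma tendsto_div_log_of_subseq {f : ℕ → ℝ} (hmono : Monotone f) (hf0 : ∀ n, 0 ≤ f n) {c : ℝ}
    (h : Tendsto (fun k : ℕ => f (2 ^ ((k + 1) ^ 2)) / (((k + 1) ^ 2 : ℕ) : ℝ)) atTop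
      (𝓝 (Real.log 2 * c))) :
    Tendsto (fun n : ℕ => f (n / 2) / Real.log n) atTop (𝓝 c) := by
  have hU : Tendsto (fun m : ℕ => f (2 ^ m) / m) atTop (𝓝 (Real.log 2 * c)) := by
    refine tendsto_div_of_monotone_of_exists_subseq_tendsto_div (fun m => f (2 ^ m)) _
      (fun m n hmn => hmono (Nat.pow_le_pow_right two_pos hmn)) fun a ha =>
        ⟨fun k => (k + 1) ^ 2, ?_, ?_, h⟩
    · have hlim : Tendsto (fun k : ℕ => (1 + 1 / ((k : ℝ) + 1)) ^ 2) atTop (𝓝 ((1 + 0) ^ 2)) :=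
        ((tendsto_one_div_add_atTop_nhds_zero_nat).const_add 1).pow 2
      rw [add_zero, one_pow] at hlim
      filter_upwards [hlim.eventually_lt_const ha] with k hk
      push_cast
      calc ((k : ℝ) + 1 + 1) ^ 2 = (1 + 1 / ((k : ℝ) + 1)) ^ 2 * (k + 1) ^ 2 := by field_simp
        _ ≤ a * (k + 1) ^ 2 := by gcongr
    · exact (tendsto_pow_atTop two_ne_zero).comp (tendsto_add_atTop_nat 1)
  have hlog2 : 0 < Real.log 2 := Real.log_pos one_lt_two
  have hr : Tendsto (fun n : ℕ => Nat.log 2 n - 1) atTop atTop :=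
    (tendsto_sub_atTop_nat 1).comp (tendsto_atTop_atTop.2 fun b =>
      ⟨2 ^ b, fun n hn => Nat.le_log_of_pow_le one_lt_two hn⟩)
  have hlow : Tendsto (fun r : ℕ => f (2 ^ r) / ((r + 2) * Real.log 2)) atTop (𝓝 c) := by
    have h1 := (hU.mul (tendsto_natCast_div_add_atTop (2 : ℝ))).div_const (Real.log 2)
    rw [mul_one, mul_div_cancel_left₀ _ hlog2.ne'] at h1
    refine h1.congr' ?_
    filter_upwards [eventually_gt_atTop 0] with r hr0
    have : (0 : ℝ) < r := by exact_mod_cast hr0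
    field_simp
  have hup : Tendsto (fun r : ℕ => f (2 ^ (r + 1)) / ((r + 1) * Real.log 2)) atTop (𝓝 c) := by
    have h1 := ((hU.comp (tendsto_add_atTop_nat 1))).div_const (Real.log 2)
    rw [mul_div_cancel_left₀ _ hlog2.ne'] at h1
    refine h1.congr fun r => ?_
    simp only [Function.comp]
    push_cast
    rw [div_div]
  refine tendsto_of_tendsto_of_tendsto_of_le_of_le' (hlow.comp hr) (hup.comp hr) ?_ ?_
  all_goals
    filter_upwards [eventually_ge_atTop 2] with n hn
    obtain ⟨r, hr'⟩ : ∃ r, Nat.log 2 n = r + 1 :=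
      ⟨Nat.log 2 n - 1, by have := Nat.log_pos one_lt_two hn; omega⟩
    have h1 : 2 ^ (r + 1) ≤ n := hr' ▸ Nat.pow_log_le_self 2 (by omega)
    have h2 : n < 2 ^ (r + 2) := by
      have := Nat.lt_pow_succ_log_self one_lt_two n
      rwa [hr'] at this
    have hn0 : (0 : ℝ) < n := by exact_mod_cast (by omega : 0 < n)
    have h3 : ((r : ℝ) + 1) * Real.log 2 ≤ Real.log n := by
      have : Real.log ((2 : ℝ) ^ (r + 1)) ≤ Real.log n :=
        Real.log_le_log (by positivity) (by exact_mod_cast h1)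
      rw [Real.log_pow] at this
      exact_mod_cast this
    have h4 : Real.log n ≤ ((r : ℝ) + 2) * Real.log 2 := by
      have : Real.log n ≤ Real.log ((2 : ℝ) ^ (r + 2)) :=
        Real.log_le_log hn0 (by exact_mod_cast h2.le)
      rw [Real.log_pow] at this
      exact_mod_cast this
    have h5 : 0 < Real.log n := lt_of_lt_of_le (by positivity) h3
    simp only [Function.comp, hr', Nat.add_sub_cancel]
    rw [pow_succ] at h1
    rw [pow_succ] at h2
  · exact div_le_div₀ (hf0 _) (hmono (by omega)) h5 h4
  · exact div_le_div₀ (hf0 _) (hmono (by omega)) (by positivity) h3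

lemma windingNumber_walk (x : ℕ → Bool) (n : ℕ) :
    windingNumber (walk x) n = 1 / 2 * crossCount (n / 2) x := by
  unfold windingNumber crossCount
  congr 1
  have hIcc : Finset.Icc 1 (n / 2) = Finset.Ico (0 + 1) (n / 2 + 1) := by
    ext i
    simp only [Finset.mem_Icc, Finset.mem_Ico]
    omega
  rw [hIcc, ← Finset.sum_Ico_add', ← Finset.range_eq_Ico]
  refine Finset.sum_congr rfl fun m _ => ?_
  rw [propext (halfWindingAt_iff x m)]

section Transfer

variable {Ω : Type*} [MeasurableSpace Ω] {μ : Measure Ω}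

/-- The tosses of a sequence of independent fair coins. -/
structure IsFairCoin (B : ℕ → Ω → Bool) (μ : Measure Ω) : Prop where
  measurable : ∀ n, Measurable (B n)
  indep : iIndepFun B μ
  fair : ∀ n b, μ (B n ⁻¹' {b}) = 1 / 2

lemma IsFairCoin.measure_cylinder {B : ℕ → Ω → Bool} (hB : IsFairCoin B μ) {n : ℕ}
    (v : Fin n → Bool) : μ ((fun ω (i : Fin n) => B i ω) ⁻¹' {v}) = (1 / 2) ^ n := by
  have h1 : (fun ω (i : Fin n) => B i ω) ⁻¹' {v} =
      ⋂ k ∈ Finset.range n, B k ⁻¹' {coinExtend v k} := by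
    ext ω
    simp only [Set.mem_preimage, Set.mem_singleton_iff, Set.mem_iInter, Finset.mem_range,
      funext_iff]
    constructor
    · intro h k hk
      simp [coinExtend, hk, ← h ⟨k, hk⟩]
    · intro h i
      simpa [coinExtend] using h i i.2
  rw [h1, hB.indep.measure_inter_preimage_eq_mul _ (fun k _ => MeasurableSet.singleton _),
    Finset.prod_congr rfl fun k _ => hB.fair k _, Finset.prod_const, Finset.card_range]

lemma IsFairCoin.measurable_of_isLocal {B : ℕ → Ω → Bool} (hB : IsFairCoin B μ) {n : ℕ}
    {F : (ℕ → Bool) → ℝ} (hF : IsLocal n F) : Measurable (fun ω => F (fun k => B k ω)) := by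
  rw [eq_comp_coinExtend hF]
  exact (measurable_of_finite _).comp (measurable_pi_lambda _ fun i => hB.measurable i)

lemma IsFairCoin.lintegral_eq {B : ℕ → Ω → Bool} (hB : IsFairCoin B μ) {n : ℕ}
    {F : (ℕ → Bool) → ℝ} (hF : IsLocal n F) (hF0 : ∀ x, 0 ≤ F x) :
    ∫⁻ ω, ENNReal.ofReal (F (fun k => B k ω)) ∂μ = ENNReal.ofReal (avg n F) := by
  have hT : Measurable (fun ω (i : Fin n) => B i ω) :=
    measurable_pi_lambda _ fun i => hB.measurable i
  have h1 : ∀ ω, F (fun k => B k ω) = F (coinExtend (fun i : Fin n => B i ω)) :=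
    congrFun (eq_comp_coinExtend hF)
  simp only [h1]
  rw [← lintegral_map (f := fun v : Fin n → Bool => ENNReal.ofReal (F (coinExtend v)))
    (measurable_of_finite _) hT, lintegral_fintype, avg_eq_sum,
    ENNReal.ofReal_sum_of_nonneg fun v _ => mul_nonneg (by positivity) (hF0 _)]
  refine Finset.sum_congr rfl fun v _ => ?_
  rw [Measure.map_apply hT (MeasurableSet.singleton v), hB.measure_cylinder, mul_comm,
    ENNReal.ofReal_mul (by positivity), ENNReal.ofReal_pow (by norm_num),
    ENNReal.ofReal_div_of_pos (by norm_num)]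
  simp

lemma IsFairCoin.ae_tendsto_subseq {B : ℕ → Ω → Bool} (hB : IsFairCoin B μ) :
    ∀ᵐ ω ∂μ, Tendsto (fun k : ℕ => crossCount (2 ^ ((k + 1) ^ 2)) (fun j => B j ω) /
      (((k + 1) ^ 2 : ℕ) : ℝ)) atTop (𝓝 (Real.log 2 / Real.pi)) := by
  set F : ℕ → (ℕ → Bool) → ℝ := fun k x =>
    (1 / (((k + 1) ^ 2 : ℕ) : ℝ)) ^ 2 * (crossCount (2 ^ ((k + 1) ^ 2)) x -
      Real.log ((2 ^ ((k + 1) ^ 2) : ℕ) : ℝ) / Real.pi) ^ 2 with hF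
  have hloc : ∀ k, IsLocal (2 * 2 ^ ((k + 1) ^ 2)) (F k) := by
    intro k x y hxy
    simp only [hF, isLocal_crossCount _ x y hxy]
  have hF0 : ∀ k x, 0 ≤ F k x := fun k x => by simp only [hF]; positivity
  have hbound : ∀ k, ∫⁻ ω, ENNReal.ofReal (F k (fun j => B j ω)) ∂μ ≤
      ENNReal.ofReal (600 * (1 / ((k + 1 : ℕ) : ℝ) ^ 2)) := by
    intro k
    rw [hB.lintegral_eq (hloc k) (hF0 k)]
    refine ENNReal.ofReal_le_ofReal ?_
    simp only [hF]
    rw [avg_mul_left]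
    refine (mul_le_mul_of_nonneg_left (avg_crossCount_sub_log_sq_le (by positivity))
      (by positivity)).trans ?_
    push_cast
    rw [Real.log_pow]
    have h2 := Real.log_two_lt_d9
    have hk : (1 : ℝ) ≤ (k + 1) ^ 2 := one_le_pow₀ (by linarith [(k.cast_nonneg : (0 : ℝ) ≤ k)])
    have h3 : 300 * (1 + ((k + 1) ^ 2 : ℕ) * Real.log 2) ≤ 600 * ((k : ℝ) + 1) ^ 2 := by
      push_cast
      nlinarith
    calc (1 / ((k : ℝ) + 1) ^ 2) ^ 2 * (300 * (1 + ((k + 1) ^ 2 : ℕ) * Real.log 2))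
        ≤ (1 / ((k : ℝ) + 1) ^ 2) ^ 2 * (600 * ((k : ℝ) + 1) ^ 2) := by gcongr
      _ = 600 * (1 / ((k : ℝ) + 1) ^ 2) := by field_simp
  have hmeas : ∀ k, Measurable (fun ω => ENNReal.ofReal (F k (fun j => B j ω))) := fun k =>
    (hB.measurable_of_isLocal (hloc k)).ennreal_ofReal
  have hsum : Summable (fun k : ℕ => 600 * (1 / ((k + 1 : ℕ) : ℝ) ^ 2)) :=
    ((summable_nat_add_iff 1).2 (Real.summable_one_div_nat_pow.2 one_lt_two)).mul_left 600
  have hfin : ∫⁻ ω, ∑' k, ENNReal.ofReal (F k (fun j => B j ω)) ∂μ ≠ ⊤ := by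
    rw [lintegral_tsum fun k => (hmeas k).aemeasurable]
    refine ne_top_of_le_ne_top ?_ (ENNReal.tsum_le_tsum hbound)
    rw [← ENNReal.ofReal_tsum_of_nonneg (fun k => by positivity) hsum]
    exact ENNReal.ofReal_ne_top
  filter_upwards [ae_lt_top (Measurable.tsum hmeas) hfin] with ω hω
  have h0 := ENNReal.tendsto_atTop_zero_of_tsum_ne_top hω.ne
  have h1 : Tendsto (fun k => F k (fun j => B j ω)) atTop (𝓝 0) := by
    have := (ENNReal.tendsto_toReal ENNReal.zero_ne_top).comp h0
    refine this.congr fun k => ?_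
    exact ENNReal.toReal_ofReal (hF0 _ _)
  have h2 : Tendsto (fun k : ℕ => |crossCount (2 ^ ((k + 1) ^ 2)) (fun j => B j ω) /
      (((k + 1) ^ 2 : ℕ) : ℝ) - Real.log 2 / Real.pi|) atTop (𝓝 0) := by
    have := h1.sqrt
    rw [Real.sqrt_zero] at this
    refine this.congr fun k => ?_
    simp only [hF]
    rw [← mul_pow, Real.sqrt_sq_eq_abs]
    congr 1
    push_cast
    rw [Real.log_pow]
    push_cast
    have : ((k : ℝ) + 1) ≠ 0 := by positivity
    field_simp
  rw [tendsto_iff_dist_tendsto_zero]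
  exact h2

lemma IsSimpleRandomWalk.isFairCoin [IsProbabilityMeasure μ] {S : ℕ → Ω → ℤ} (hS : IsSimpleRandomWalk S μ) :
    IsFairCoin (fun n ω => decide (S (n + 1) ω - S n ω = 1)) μ := by
  have hm : ∀ n, Measurable (fun ω => decide (S (n + 1) ω - S n ω = 1)) := fun n =>
    (measurable_of_countable (fun z : ℤ => decide (z = 1))).comp
      ((hS.measurable (n + 1)).sub (hS.measurable n))
  have ht : ∀ n, μ ((fun ω => decide (S (n + 1) ω - S n ω = 1)) ⁻¹' {true}) = 1 / 2 := by
    intro n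
    rw [← hS.step_up n]
    congr 1
    ext ω
    simp
  refine ⟨hm, ?_, fun n b => ?_⟩
  · exact hS.indep.comp (fun _ z => decide (z = 1)) fun _ => measurable_of_countable _
  · cases b with
    | true => exact ht n
    | false =>
      have : (fun ω => decide (S (n + 1) ω - S n ω = 1)) ⁻¹' {false} =
          ((fun ω => decide (S (n + 1) ω - S n ω = 1)) ⁻¹' {true})ᶜ := by
        ext ω
        simp
      rw [this, prob_compl_eq_one_sub (hm n (MeasurableSet.singleton _)), ht]
      simp

lemma IsSimpleRandomWalk.ae_eq_walk [IsProbabilityMeasure μ] {S : ℕ → Ω → ℤ} (hS : IsSimpleRandomWalk S μ) :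
    ∀ᵐ ω ∂μ, (fun k => S k ω) = walk (fun n => decide (S (n + 1) ω - S n ω = 1)) := by
  have hstep : ∀ n, ∀ᵐ ω ∂μ, S (n + 1) ω - S n ω = 1 ∨ S (n + 1) ω - S n ω = -1 := by
    intro n
    have hd := (hS.measurable (n + 1)).sub (hS.measurable n)
    have h1 : MeasurableSet {ω | S (n + 1) ω - S n ω = 1} := hd (MeasurableSet.singleton 1)
    have h2 : MeasurableSet {ω | S (n + 1) ω - S n ω = -1} := hd (MeasurableSet.singleton (-1))
    refine (mem_ae_iff_prob_eq_one (h1.union h2)).2 ?_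
    rw [measure_union _ h2, hS.step_up, hS.step_down, ENNReal.add_halves]
    rw [Set.disjoint_left]
    intro ω h3 h4
    simp only [Set.mem_ofPred_eq] at h3 h4
    omega
  filter_upwards [hS.zero, ae_all_iff.2 hstep] with ω h0 h
  funext k
  induction k with
  | zero => rw [h0, walk_zero]
  | succ k ih =>
    rw [walk_succ, ← ih]
    rcases h k with h | h <;> simp [h, coinStep] <;> omega

end Transfer

end RevolvingWalk

theorem theorem5 {Ω : Type*} [MeasurableSpace Ω] (μ : Measure Ω) [IsProbabilityMeasure μ]
    (S : ℕ → Ω → ℤ) (hS : RevolvingWalk.IsSimpleRandomWalk S μ) :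
    ∀ᵐ ω ∂μ, Tendsto
      (fun n : ℕ => RevolvingWalk.windingNumber (fun k => S k ω) n / Real.log (n : ℝ))
      atTop (𝓝 (1 / (2 * Real.pi))) := by
  filter_upwards [hS.isFairCoin.ae_tendsto_subseq, hS.ae_eq_walk] with ω h1 h2
  rw [h2]
  rw [div_eq_mul_one_div] at h1
  have h3 := (RevolvingWalk.tendsto_div_log_of_subseq (RevolvingWalk.crossCount_mono _)
    (fun n => Finset.sum_nonneg fun _ _ => by split_ifs <;> norm_num) h1).const_mul (1 / 2)
  rw [one_div_mul_one_div] at h3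
  refine h3.congr fun n => ?_
  rw [RevolvingWalk.windingNumber_walk, mul_div_assoc]
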